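/- Let $\mathcal D$ be a dimer model on the two-torus: a non-empty finite connected bipartite graph with edge set $\mathcal E$ (multiple edges allowed), embedded in the torus so that all complementary regions are discs. Let $V$ be its number of vertices and $g$ its number of faces. Assume that $\mathcal D$ is non-degenerate: every edge lies in some perfect matching (a set of edges that covers every vertex exactly once). Let $p_1,\dots,p_c$ be the perfect matchings and let $P$ be the $\mathcal E\times c$ matrix with $P_{e\alpha}=1$ if $e\in p_\alpha$ and $P_{e\alpha}=0$ otherwise. The associated toric quiver gauge theory with gauge group $U(1)^g$ has one field $X_e$ for each edge and the superpotential $$W=\sum_{w\ \text{white}}\ \prod_{e\ni w}X_e-\sum_{b\ \text{black}}\ \prod_{e\ni b}X_e .$$ Its master space is the affine scheme $\operatorname{Spec}\mathbb C[X_e: e\in\mathcal E]/(\partial W/\partial X_e: e\in \mathcal E)$. Its coherent component is the irreducible component of largest dimension, with its reduced structure. Then the following hold. 1. Every perfect matching has exactly $V/2$ edges; equivalently $(1,\dots,1)\cdot P=\frac V2(1,\dots,1)$. 2. The master space has exactly one irreducible component of largest dimension. Let $R=\mathbb C[X_e]/\mathfrak p$ be the coordinate ring of this coherent component. 3. The coherent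 component is an affine Calabi–Yau variety of dimension $g+2$ (singularities allowed): $R$ is a finitely generated integrally closed domain of Krull dimension $g+2$, and its canonical module $(\bigwedge^{g+2}\Omega_{R/\mathbb C})^{**}$ is isomorphic to $R$ (so the canonical divisor is trivial and in particular Cartier, i.e. the variety is Gorenstein in the sense of toric geometry). 4. Let $Q$ be any integer matrix with $c$ rows whose columns form a $\mathbb Z$-basis of $\ker(P:\mathbb Z^c\to\mathbb Z^{\mathcal E})$. Then $Q$ has $c-g-2$ columns, and the coherent component is $\mathbb C^c/\!/Q^t$: the map $X_e\mapsto\prod_\alpha p_\alpha^{P_{e\alpha}}$ induces an isomorphism of $R$ onto the ring of invariants of $\mathbb C[p_1,\dots,p_c]$ under the torus $(\mathbb C^*)^{c-g-2}$ that acts with the rows of $Q^t$ as vectors of charges. Moreover $(1,\dots,1)\cdot Q=0$, i.e. all vectors of charges are traceless. 5. The coherent component is toric, with coplanar toric diagram: there are integer matrices $K$ of size $(g+2)\times\mathcal E$ and $T$ of size $(g+2)\times c$ such that $K^tT=P$, the columns of $K$ and those of $T$ each generate the group $\mathbb Z^{g+2}$, and, $\sigma$ being the cone generated by the columns of $T$,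 the semigroup $\sigma^\vee\cap\mathbb Z^{g+2}$ is generated by the columns of $K$ and $R\cong\mathbb C[\sigma^\vee\cap\mathbb Z^{g+2}]$ by an isomorphism that sends $X_e$ to the character $\chi^{K_e}$ given by the column $K_e$. No column of $T$ lies in the cone generated by the others (the columns of $T$ are the generators of the rays of $\sigma$), and all columns of $T$ lie on one hyperplane $\{v:\langle u,v\rangle=1\}$ with $u\in\mathbb Z^{g+2}$. -/

import Mathlib

open scoped BigOperators Matrix KaehlerDifferential

noncomputable section

/-- The number of cycles (fixed points included) of a permutation. -/
def numCycles {E : Type*} (s : Equiv.Perm E) : ℕ :=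
  Nat.card (Quotient (Equiv.Perm.SameCycle.setoid s))

/-- A dimer model (brane tiling) on the two-torus with set of edges `E`: a non-empty finite
connected bipartite graph (multiple edges allowed) embedded in the torus so that all complementary
regions are discs. It is encoded as a bipartite combinatorial map: `white` sends an edge to the
next one in anticlockwise order around its white end, `black` to the next one in anticlockwise
order around its black end. The white vertices, black vertices and faces are the cycles of
`white`, `black` and `black * white`, and the surface is the torus exactly if the map is connected
with Euler characteristic `0`. -/
structure TorusDimer (E : Type*) [Fintype E] where
  white : Equiv.Perm E
  black : Equiv.Perm E
  nonempty : Nonempty E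
  connected : ∀ e e' : E, ∃ s ∈ Subgroup.closure {white, black}, s e = e'
  euler : numCycles white + numCycles black + numCycles (black * white) = Fintype.card E

namespace TorusDimer

variable {E : Type*} [Fintype E] (D : TorusDimer E)

/-- The white vertices. -/
def White : Type _ := Quotient (Equiv.Perm.SameCycle.setoid D.white)

/-- The black vertices. -/
def Black : Type _ := Quotient (Equiv.Perm.SameCycle.setoid D.black)

/-- The white end of an edge. -/
def whiteEnd (e : E) : D.White := Quotient.mk (Equiv.Perm.SameCycle.setoid D.white) e

/-- The black end of an edge. -/
def blackEnd (e : E) : D.Black := Quotient.mk (Equiv.Perm.SameCycle.setoid D.black) e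

instance : Finite D.White := inferInstanceAs (Finite (Quotient _))

instance : Finite D.Black := inferInstanceAs (Finite (Quotient _))

instance : Fintype D.White := Fintype.ofFinite _

instance : Fintype D.Black := Fintype.ofFinite _

/-- The number `V` of vertices of the tiling, i.e. of terms of the superpotential. -/
def numVertices : ℕ := numCycles D.white + numCycles D.black

/-- The number `g` of faces of the tiling, i.e. of gauge groups (nodes of the quiver). -/
def numGaugeGroups : ℕ := numCycles (D.black * D.white)

/-- A set of edges that covers every vertex exactly once. -/
def IsPerfectMatching (m : Finset E) : Prop :=
  (∀ v : D.White, ∃! e, e ∈ m ∧ D.whiteEnd e = v) ∧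
    ∀ v : D.Black, ∃! e, e ∈ m ∧ D.blackEnd e = v

/-- The perfect matchings. -/
def PerfectMatching : Type _ := {m : Finset E // D.IsPerfectMatching m}

instance : Finite D.PerfectMatching := inferInstanceAs (Finite {m : Finset E // D.IsPerfectMatching m})

instance : Fintype D.PerfectMatching := Fintype.ofFinite _

/-- Every edge lies in some perfect matching. -/
def IsNondegenerate : Prop := ∀ e : E, ∃ m : D.PerfectMatching, e ∈ m.1

open Classical in
/-- The `E × c` matrix `P`, whose columns are the indicator vectors of the perfect matchings. -/
def matchingMatrix : Matrix E D.PerfectMatching ℤ :=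
  Matrix.of fun e m => if e ∈ m.1 then 1 else 0

open Classical in
/-- The superpotential of the `U(1)^g` theory: one field for each edge, one term for each vertex
(the product of the fields at it), with sign `+` at white and `-` at black vertices. -/
def superpotential : MvPolynomial E ℂ :=
  (∑ v : D.White, ∏ e with D.whiteEnd e = v, MvPolynomial.X e) -
    ∑ v : D.Black, ∏ e with D.blackEnd e = v, MvPolynomial.X e

/-- The ideal of the F-terms, i.e. of the master space in `ℂ^E`. -/
def fTermIdeal : Ideal (MvPolynomial E ℂ) :=
  Ideal.span (Set.range fun e => MvPolynomial.pderiv e D.superpotential)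

/-- The prime ideal `p` cuts out an irreducible component of the master space, and no irreducible
component has a larger dimension. -/
def IsTopComponent (p : Ideal (MvPolynomial E ℂ)) : Prop :=
  p ∈ D.fTermIdeal.minimalPrimes ∧
    ∀ q ∈ D.fTermIdeal.minimalPrimes,
      ringKrullDim (MvPolynomial E ℂ ⧸ q) ≤ ringKrullDim (MvPolynomial E ℂ ⧸ p)

open Classical in
/-- The map `ℂ[X_e : e ∈ E] → ℂ[p_1, …, p_c]` with `X_e ↦ ∏_α p_α ^ P_{eα}`. -/
def matchingMap : MvPolynomial E ℂ →ₐ[ℂ] MvPolynomial D.PerfectMatching ℂ :=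
  MvPolynomial.aeval fun e => ∏ m with e ∈ m.1, MvPolynomial.X m

end TorusDimer

/-- The columns of `Q` are a `ℤ`-basis of the kernel of `P`. -/
def IsKernelMatrix {m n : Type*} [Fintype n] {r : ℕ}
    (P : Matrix m n ℤ) (Q : Matrix n (Fin r) ℤ) : Prop :=
  LinearIndependent ℤ Q.col ∧
    Submodule.span ℤ (Set.range Q.col) = LinearMap.ker P.mulVecLin

/-- The action of `t ∈ (ℂˣ)^r` on `ℂ[p_α]` in which `p_α` has charges `Q α 1, …, Q α r`, the
vectors of charges being the rows of `Qᵀ`. -/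
def chargeAction {ι : Type*} {r : ℕ} (Q : Matrix ι (Fin r) ℤ) (t : Fin r → ℂˣ) :
    MvPolynomial ι ℂ →ₐ[ℂ] MvPolynomial ι ℂ :=
  MvPolynomial.aeval fun a =>
    MvPolynomial.C ((∏ i, t i ^ Q a i : ℂˣ) : ℂ) * MvPolynomial.X a

/-- The coordinate ring of the quotient `ℂ^c // Qᵀ`: the invariants of the torus `(ℂˣ)^r` acting
with the charges `Qᵀ`. -/
def quotientRing {ι : Type*} {r : ℕ} (Q : Matrix ι (Fin r) ℤ) :
    Subalgebra ℂ (MvPolynomial ι ℂ) :=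
  ⨅ t : Fin r → ℂˣ, AlgHom.equalizer (chargeAction Q t) (AlgHom.id ℂ (MvPolynomial ι ℂ))

/-- The semigroup `σ^∨ ∩ ℤ^n` of the lattice points of the dual of the cone `σ ⊆ ℝ^n` that is
generated by the columns of `T`. -/
def dualSemigroup {n : ℕ} {ι : Type*} (T : Matrix (Fin n) ι ℤ) : AddSubmonoid (Fin n → ℤ) where
  carrier := {u | ∀ a, 0 ≤ u ⬝ᵥ T.col a}
  zero_mem' := fun a => by simp
  add_mem' := fun {u v} hu hv a => by
    rw [add_dotProduct]
    exact add_nonneg (hu a) (hv a)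

/-- The cone in `ℝ^n` generated by a set of columns of `T`. -/
def columnCone {n : ℕ} {ι : Type*} (T : Matrix (Fin n) ι ℤ) (s : Set ι) :
    PointedCone ℝ (Fin n → ℝ) :=
  Submodule.span _ ((fun a i => (T i a : ℝ)) '' s)

/-- The canonical module `(⋀^d Ω_{R/ℂ})**` of a normal affine variety of dimension `d` with
coordinate ring `R`: the reflexive hull of the module of differential forms of top degree. -/
abbrev CanonicalModule (R : Type*) [CommRing R] [Algebra ℂ R] (d : ℕ) : Type _ :=
  Module.Dual R (Module.Dual R (⋀[R]^d (Ω[R⁄ℂ])))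

/-- `R` is the coordinate ring of an affine Calabi--Yau variety of dimension `d` (singularities
allowed): a normal variety with trivial canonical sheaf. In particular its canonical divisor is
Cartier. -/
structure IsAffineCalabiYau (R : Type*) [CommRing R] [Algebra ℂ R] (d : ℕ) : Prop where
  isDomain : IsDomain R
  finiteType : Algebra.FiniteType ℂ R
  isIntegrallyClosed : IsIntegrallyClosed R
  ringKrullDim_eq : ringKrullDim R = d
  canonical_trivial : Nonempty (CanonicalModule R d ≃ₗ[R] R)

end

/-!
The toric structure of the coherent component comes from the lattice `M` of the integral weightings
of the edges whose sums at all vertices agree (the kernel of `TorusDimer.excess`). As the graph is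
connected with `V` vertices and, by Euler's formula, `V + g` edges, `M` has rank `g + 2`. In a basis
of `M` the values on the edges form the matrix `K` and the coordinates of the perfect matchings the
matrix `T`. The columns of `K` span, as `M` is a direct summand; those of `T` span, as a regular
bipartite multigraph decomposes into perfect matchings (Kőnig's theorem,
`TorusDimer.exists_sum_matching_of_regular`) and every weighting in `M` becomes one after a multiple
of the sum of all perfect matchings is added, by non-degeneracy.

Egerváry's duality between perfect matchings of minimal weight and vertex potentials
(`TorusDimer.exists_tight_potential`) says that a weighting that vanishes on all perfect matchings
is a potential of total value zero, and that a weighting that is non-negative on them can be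
replaced by a non-negative one. The second fact makes the columns of `K` generate the semigroup of
the dual cone and identifies the image of `matchingMap` with the ring of invariants. The first one
says that elements with the same product at all vertices satisfy every multiplicative relation that
holds on the image of `matchingMap`. On the master space all vertex monomials agree by
connectedness, so any component on which no field vanishes lies in the variety of the kernel of
`matchingMap`.

On a component on which some field vanishes, so do all vertex monomials. The vanishing fields,
together with the F-terms of those that vanish alone at their ends, give at least `V - 1`
independent relations, so that the dimension is at most `g + 1`
(`TorusDimer.FTerms.ringKrullDim_le_of_eq_zero`). Hence the kernel of `matchingMap`, of dimension
`g + 2`, is the only component of largest dimension.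

As a ring of invariants, the coordinate ring is saturated in a polynomial ring, hence integrally
closed. For the canonical module (`TorusDimer.canonicalModule_trivial`), the rows of `K` give
`g + 2` commuting vector fields, and their determinant is a form on `⋀^{g+2} Ω` whose values are the
monomials `∏ X_{e_j}` times minors of `K`. This form is divisible by the common vertex monomial,
which generates the functions that vanish on the boundary divisor, and the quotient generates the
dual module: a minor that does not vanish meets every perfect matching, and for every perfect
matching some such minor meets it just once.
-/

noncomputable section

open scoped Classical

/-! ### Perfect matchings of the tiling -/

namespace TorusDimer

variable {E : Type*} [Fintype E] (D : TorusDimer E)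

lemma whiteEnd_white (e : E) : D.whiteEnd (D.white e) = D.whiteEnd e :=
  Quotient.sound (s := Equiv.Perm.SameCycle.setoid D.white)
    ((Equiv.Perm.sameCycle_apply_left).2 (Equiv.Perm.SameCycle.refl _ _))

lemma blackEnd_black (e : E) : D.blackEnd (D.black e) = D.blackEnd e :=
  Quotient.sound (s := Equiv.Perm.SameCycle.setoid D.black)
    ((Equiv.Perm.sameCycle_apply_left).2 (Equiv.Perm.SameCycle.refl _ _))

lemma whiteEnd_surjective : Function.Surjective D.whiteEnd := Quotient.mk_surjective

lemma blackEnd_surjective : Function.Surjective D.blackEnd := Quotient.mk_surjective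

/-- The graph is connected: functions on the white and on the black vertices that agree along
every edge are constant. -/
lemma exists_eq_const_of_ends {X : Type*} (φ : D.White → X) (ψ : D.Black → X)
    (h : ∀ e, φ (D.whiteEnd e) = ψ (D.blackEnd e)) : ∃ x, (∀ v, φ v = x) ∧ ∀ v, ψ v = x := by
  obtain ⟨e₀⟩ := D.nonempty
  have key : ∀ s ∈ Subgroup.closure {D.white, D.black}, ∀ e,
      φ (D.whiteEnd (s e)) = φ (D.whiteEnd e) := by
    intro s hs
    induction hs using Subgroup.closure_induction with
    | mem s hs =>
      rcases hs with rfl | hs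
      · intro e
        rw [whiteEnd_white]
      · rw [Set.mem_singleton_iff] at hs
        subst hs
        intro e
        rw [h, blackEnd_black, h]
    | one => simp
    | mul s t _ _ hs ht =>
      intro e
      rw [Equiv.Perm.mul_apply, hs, ht]
    | inv s _ hs =>
      intro e
      rw [← hs, ← Equiv.Perm.mul_apply, mul_inv_cancel, Equiv.Perm.one_apply]
  have hw : ∀ e, φ (D.whiteEnd e) = φ (D.whiteEnd e₀) := by
    intro e
    obtain ⟨s, hs, rfl⟩ := D.connected e₀ e
    exact key s hs e₀
  refine ⟨φ (D.whiteEnd e₀), fun v => ?_, fun v => ?_⟩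
  · obtain ⟨e, rfl⟩ := D.whiteEnd_surjective v
    exact hw e
  · obtain ⟨e, rfl⟩ := D.blackEnd_surjective v
    rw [← h, hw]

instance : Nonempty D.White := D.nonempty.map D.whiteEnd

instance : Nonempty D.Black := D.nonempty.map D.blackEnd

lemma sum_matching_white {M : Type*} [AddCommMonoid M] (m : D.PerfectMatching) (g : D.White → M) :
    ∑ e ∈ m.1, g (D.whiteEnd e) = ∑ v, g v := by
  refine Finset.sum_bij (fun e _ => D.whiteEnd e) (fun _ _ => Finset.mem_univ _) ?_ ?_
    fun _ _ => rfl
  · intro e he e' he' h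
    exact (m.2.1 (D.whiteEnd e')).unique ⟨he, h⟩ ⟨he', rfl⟩
  · intro v _
    obtain ⟨e, he, -⟩ := m.2.1 v
    exact ⟨e, he.1, he.2⟩

lemma sum_matching_black {M : Type*} [AddCommMonoid M] (m : D.PerfectMatching) (g : D.Black → M) :
    ∑ e ∈ m.1, g (D.blackEnd e) = ∑ v, g v := by
  refine Finset.sum_bij (fun e _ => D.blackEnd e) (fun _ _ => Finset.mem_univ _) ?_ ?_
    fun _ _ => rfl
  · intro e he e' he' h
    exact (m.2.2 (D.blackEnd e')).unique ⟨he, h⟩ ⟨he', rfl⟩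
  · intro v _
    obtain ⟨e, he, -⟩ := m.2.2 v
    exact ⟨e, he.1, he.2⟩

lemma sum_star_white {M : Type*} [AddCommMonoid M] (m : D.PerfectMatching) (v : D.White)
    (x : M) : ∑ e with D.whiteEnd e = v, (if e ∈ m.1 then x else 0) = x := by
  obtain ⟨e, he, hu⟩ := m.2.1 v
  rw [Finset.sum_eq_single e]
  · simp [he.1]
  · intro b hb hbe
    rw [if_neg]
    exact fun hm => hbe (hu b ⟨hm, (Finset.mem_filter.1 hb).2⟩)
  · simp [he.2]

lemma sum_star_black {M : Type*} [AddCommMonoid M] (m : D.PerfectMatching) (v : D.Black)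
    (x : M) : ∑ e with D.blackEnd e = v, (if e ∈ m.1 then x else 0) = x := by
  obtain ⟨e, he, hu⟩ := m.2.2 v
  rw [Finset.sum_eq_single e]
  · simp [he.1]
  · intro b hb hbe
    rw [if_neg]
    exact fun hm => hbe (hu b ⟨hm, (Finset.mem_filter.1 hb).2⟩)
  · simp [he.2]

lemma card_matching_white (m : D.PerfectMatching) : m.1.card = Fintype.card D.White := by
  rw [Finset.card_eq_sum_ones, D.sum_matching_white m (fun _ => 1), Fintype.card_eq_sum_ones]

lemma card_matching_black (m : D.PerfectMatching) : m.1.card = Fintype.card D.Black := by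
  rw [Finset.card_eq_sum_ones, D.sum_matching_black m (fun _ => 1), Fintype.card_eq_sum_ones]

lemma card_white_add_card_black : Fintype.card D.White + Fintype.card D.Black = D.numVertices := by
  rw [← Nat.card_eq_fintype_card, ← Nat.card_eq_fintype_card]
  rfl

lemma card_edges : D.numVertices + D.numGaugeGroups = Fintype.card E := D.euler

variable {D} in
lemma IsNondegenerate.nonempty_matching (hD : D.IsNondegenerate) : Nonempty D.PerfectMatching :=
  D.nonempty.elim fun e => ⟨(hD e).choose⟩

/-- Hall's marriage theorem for the edges with a given property. -/
lemma exists_matching_of_hall (hc : Fintype.card D.White = Fintype.card D.Black) (p : E → Prop)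
    (h : ∀ (S : Finset D.White) (N : Finset D.Black),
      (∀ e, p e → D.whiteEnd e ∈ S → D.blackEnd e ∈ N) → S.card ≤ N.card) :
    ∃ m : D.PerfectMatching, ∀ e ∈ m.1, p e := by
  obtain ⟨f, hf, hf'⟩ := (Finset.all_card_le_biUnion_card_iff_exists_injective
    (fun v : D.White => Finset.univ.filter fun u : D.Black =>
      ∃ e, p e ∧ D.whiteEnd e = v ∧ D.blackEnd e = u)).1 (by
    intro S
    refine h S _ fun e he heS => Finset.mem_biUnion.2 ⟨_, heS, ?_⟩
    exact Finset.mem_filter.2 ⟨Finset.mem_univ _, e, he, rfl, rfl⟩)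
  have hbij : Function.Bijective f := (Fintype.bijective_iff_injective_and_card f).2 ⟨hf, hc⟩
  choose e he using fun v => (Finset.mem_filter.1 (hf' v)).2
  refine ⟨⟨Finset.univ.image e, fun v => ⟨e v, ⟨by simp, (he v).2.1⟩, ?_⟩, fun u => ?_⟩, ?_⟩
  · rintro e' ⟨he', rfl⟩
    obtain ⟨v, -, rfl⟩ := Finset.mem_image.1 he'
    rw [(he v).2.1]
  · obtain ⟨v, rfl⟩ := hbij.2 u
    refine ⟨e v, ⟨by simp, (he v).2.2⟩, ?_⟩
    rintro e' ⟨he', hb⟩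
    obtain ⟨v', -, rfl⟩ := Finset.mem_image.1 he'
    rw [(he v').2.2] at hb
    rw [hf hb]
  · intro e' he'
    obtain ⟨v, -, rfl⟩ := Finset.mem_image.1 he'
    exact (he v).1

/-- Egerváry's theorem: the minimal weight of a perfect matching for integral weights `x` is the
maximal total value of an integral potential on the vertices whose sum along every edge is at most
the weight of that edge. A potential of maximal total value has a perfect matching among its tight
edges, since a violation of Hall's condition would allow to increase the total value. -/
theorem exists_tight_potential (hc : Fintype.card D.White = Fintype.card D.Black)
    (hm : Nonempty D.PerfectMatching) (x : E → ℤ) :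
    ∃ (a : D.White → ℤ) (b : D.Black → ℤ) (m : D.PerfectMatching),
      (∀ e, a (D.whiteEnd e) + b (D.blackEnd e) ≤ x e) ∧
      ∀ e ∈ m.1, a (D.whiteEnd e) + b (D.blackEnd e) = x e := by
  obtain ⟨m₀⟩ := hm
  obtain ⟨s, ⟨a, b, hab, hs⟩, hmax⟩ := Int.exists_greatest_of_bdd
    (P := fun s => ∃ (a : D.White → ℤ) (b : D.Black → ℤ),
      (∀ e, a (D.whiteEnd e) + b (D.blackEnd e) ≤ x e) ∧ ∑ v, a v + ∑ v, b v = s)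
    ⟨∑ e ∈ m₀.1, x e, by
      rintro s ⟨a, b, hab, rfl⟩
      rw [← D.sum_matching_white m₀, ← D.sum_matching_black m₀, ← Finset.sum_add_distrib]
      exact Finset.sum_le_sum fun e _ => hab e⟩
    ⟨_, fun _ => -∑ e, |x e|, fun _ => 0, fun e => by
      have := Finset.single_le_sum (f := fun e => |x e|) (fun e _ => abs_nonneg _)
        (Finset.mem_univ e)
      have := neg_abs_le (x e)
      simp only at *
      linarith, rfl⟩
  obtain ⟨m, hm⟩ := D.exists_matching_of_hall hc
    (fun e => a (D.whiteEnd e) + b (D.blackEnd e) = x e) (by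
    by_contra! hcon
    obtain ⟨S, N, hN, hS⟩ := hcon
    -- raise the potential on `S` and lower it on a set `N` that contains its tight neighbours
    have := hmax (s + S.card - N.card) ⟨fun v => a v + if v ∈ S then 1 else 0,
      fun u => b u - if u ∈ N then 1 else 0, fun e => ?_, ?_⟩
    · omega
    · have h1 := hab e
      by_cases hv : D.whiteEnd e ∈ S <;> by_cases hu : D.blackEnd e ∈ N
      · simp only [hv, hu, if_true]; linarith
      · have : a (D.whiteEnd e) + b (D.blackEnd e) ≠ x e := fun h =>
          hu (hN e h hv)
        simp only [hv, hu, if_true, if_false]; omega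
      · simp only [hv, hu, if_true, if_false]; linarith
      · simp only [hv, hu, if_false]; linarith
    · rw [Finset.sum_add_distrib, Finset.sum_sub_distrib, ← hs]
      simp only [Finset.sum_ite_mem, Finset.univ_inter, Finset.sum_const, mul_one, nsmul_eq_mul]
      ring)
  exact ⟨a, b, m, hab, hm⟩

lemma sum_eq_sum_star_white {M : Type*} [AddCommMonoid M] (S : Finset D.White) (f : E → M) :
    ∑ e with D.whiteEnd e ∈ S, f e = ∑ v ∈ S, ∑ e with D.whiteEnd e = v, f e := by
  rw [← Finset.sum_fiberwise_of_maps_to (t := S) (g := D.whiteEnd)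
    (fun e he => (Finset.mem_filter.1 he).2)]
  refine Finset.sum_congr rfl fun v hv => Finset.sum_congr ?_ fun _ _ => rfl
  ext e
  simp only [Finset.mem_filter, Finset.mem_univ, true_and]
  exact ⟨fun h => h.2, fun h => ⟨h ▸ hv, h⟩⟩

lemma sum_eq_sum_star_black {M : Type*} [AddCommMonoid M] (S : Finset D.Black) (f : E → M) :
    ∑ e with D.blackEnd e ∈ S, f e = ∑ v ∈ S, ∑ e with D.blackEnd e = v, f e := by
  rw [← Finset.sum_fiberwise_of_maps_to (t := S) (g := D.blackEnd)
    (fun e he => (Finset.mem_filter.1 he).2)]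
  refine Finset.sum_congr rfl fun v hv => Finset.sum_congr ?_ fun _ _ => rfl
  ext e
  simp only [Finset.mem_filter, Finset.mem_univ, true_and]
  exact ⟨fun h => h.2, fun h => ⟨h ▸ hv, h⟩⟩

/-- Kőnig's theorem: a regular bipartite multigraph decomposes into perfect matchings. -/
theorem exists_sum_matching_of_regular (hc : Fintype.card D.White = Fintype.card D.Black) (d : ℕ)
    (f : E → ℕ) (hw : ∀ v, ∑ e with D.whiteEnd e = v, f e = d)
    (hb : ∀ v, ∑ e with D.blackEnd e = v, f e = d) :
    ∃ c : D.PerfectMatching → ℕ, ∀ e, f e = ∑ m, if e ∈ m.1 then c m else 0 := by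
  induction d generalizing f with
  | zero =>
    refine ⟨0, fun e => ?_⟩
    have := hw (D.whiteEnd e)
    rw [Finset.sum_eq_zero_iff] at this
    simpa using this e (by simp)
  | succ d ih =>
    obtain ⟨m, hm⟩ := D.exists_matching_of_hall hc (fun e => f e ≠ 0) (by
      intro S N hN
      -- the edges at `S` carry the weight `(d + 1) |S|` and all end in `N`
      have h1 : ∑ e with D.whiteEnd e ∈ S, f e = S.card * (d + 1) := by
        rw [sum_eq_sum_star_white, Finset.sum_congr rfl fun v _ => hw v]
        simp
      have h2 : ∑ e with D.blackEnd e ∈ N, f e = N.card * (d + 1) := by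
        rw [sum_eq_sum_star_black, Finset.sum_congr rfl fun v _ => hb v]
        simp
      have h3 : ∑ e with D.whiteEnd e ∈ S, f e ≤ ∑ e with D.blackEnd e ∈ N, f e := by
        rw [Finset.sum_filter, Finset.sum_filter]
        refine Finset.sum_le_sum fun e _ => ?_
        by_cases hS : D.whiteEnd e ∈ S
        · by_cases h0 : f e = 0
          · simp [h0]
          · simp [hS, hN e h0 hS]
        · simp [hS]
      rw [h1, h2] at h3
      exact Nat.le_of_mul_le_mul_right h3 d.succ_pos)
    have hf : ∀ e, f e = (f e - if e ∈ m.1 then 1 else 0) + if e ∈ m.1 then 1 else 0 := by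
      intro e
      by_cases he : e ∈ m.1
      · have := hm e he
        simp only [he, if_true]
        omega
      · simp [he]
    obtain ⟨c, hcf⟩ := ih (fun e => f e - if e ∈ m.1 then 1 else 0)
      (fun v => by
        have := hw v
        rw [Finset.sum_congr rfl fun e _ => hf e, Finset.sum_add_distrib,
          D.sum_star_white m v 1] at this
        exact Nat.succ_injective this)
      (fun v => by
        have := hb v
        rw [Finset.sum_congr rfl fun e _ => hf e, Finset.sum_add_distrib,
          D.sum_star_black m v 1] at this
        exact Nat.succ_injective this)
    refine ⟨fun m' => c m' + if m' = m then 1 else 0, fun e => ?_⟩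
    rw [hf e, hcf e]
    have : ∀ m' : D.PerfectMatching, (if e ∈ m'.1 then c m' + (if m' = m then 1 else 0) else 0) =
        (if e ∈ m'.1 then c m' else 0) + if m' = m then (if e ∈ m'.1 then 1 else 0) else 0 := by
      intro m'
      split_ifs <;> rfl
    rw [Finset.sum_congr rfl fun m' _ => this m', Finset.sum_add_distrib]
    simp

end TorusDimer

/-! ### The lattice of weightings with equal vertex sums, and its cone -/

namespace TorusDimer

variable {E : Type*} [Fintype E] (D : TorusDimer E)

variable {D} in
lemma IsNondegenerate.card_white_eq (hD : D.IsNondegenerate) :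
    Fintype.card D.White = Fintype.card D.Black := by
  obtain ⟨m⟩ := hD.nonempty_matching
  rw [← D.card_matching_white m, ← D.card_matching_black m]

lemma matchingMatrix_apply (e : E) (m : D.PerfectMatching) :
    D.matchingMatrix e m = if e ∈ m.1 then 1 else 0 := by
  unfold matchingMatrix
  rw [Matrix.of_apply]

lemma sum_mul_matchingMatrix (x : E → ℤ) (m : D.PerfectMatching) :
    ∑ e, x e * D.matchingMatrix e m = ∑ e ∈ m.1, x e := by
  simp only [matchingMatrix_apply, mul_ite, mul_one, mul_zero]
  rw [Finset.sum_ite_mem, Finset.univ_inter]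

/-- The map that sends an integral weighting `f` of the edges and an integer `d` to the sums of `f`
at the vertices, reduced by `d`. Its kernel is the lattice of the weightings whose sums at all
vertices agree. -/
def excess : (E → ℤ) × ℤ →ₗ[ℤ] (D.White → ℤ) × (D.Black → ℤ) where
  toFun x := (fun v => ∑ e with D.whiteEnd e = v, x.1 e - x.2,
    fun v => ∑ e with D.blackEnd e = v, x.1 e - x.2)
  map_add' x y := by
    ext v <;> simp [Finset.sum_add_distrib] <;> ring
  map_smul' c x := by
    ext v <;> simp [← Finset.mul_sum] <;> ring

lemma mem_ker_excess {x : (E → ℤ) × ℤ} : x ∈ LinearMap.ker D.excess ↔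
    (∀ v, ∑ e with D.whiteEnd e = v, x.1 e = x.2) ∧
      ∀ v, ∑ e with D.blackEnd e = v, x.1 e = x.2 := by
  simp [excess, LinearMap.mem_ker, Prod.ext_iff, funext_iff, sub_eq_zero]

/-- The difference of the sums over the white and over the black vertices. -/
def imbalance : (D.White → ℤ) × (D.Black → ℤ) →ₗ[ℤ] ℤ where
  toFun x := ∑ v, x.1 v - ∑ v, x.2 v
  map_add' x y := by
    simp [Finset.sum_add_distrib]
    ring
  map_smul' c x := by
    simp [← Finset.mul_sum]
    ring

lemma sum_sum_white {M : Type*} [AddCommMonoid M] (f : E → M) :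
    ∑ v, ∑ e with D.whiteEnd e = v, f e = ∑ e, f e := by
  rw [← D.sum_eq_sum_star_white Finset.univ f]
  simp

lemma sum_sum_black {M : Type*} [AddCommMonoid M] (f : E → M) :
    ∑ v, ∑ e with D.blackEnd e = v, f e = ∑ e, f e := by
  rw [← D.sum_eq_sum_star_black Finset.univ f]
  simp

/-- By connectedness, a vertex function is a boundary up to a constant exactly if it is balanced. -/
lemma range_excess (hc : Fintype.card D.White = Fintype.card D.Black) :
    LinearMap.range D.excess = LinearMap.ker D.imbalance := by
  apply le_antisymm
  · rintro _ ⟨x, rfl⟩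
    simp [LinearMap.mem_ker, excess, imbalance, Finset.sum_sub_distrib, sum_sum_white,
      sum_sum_black, hc]
  · rintro ⟨a, b⟩ hab
    -- modulo boundaries, all white vertices become equal, and all black ones become their negative
    let π := (LinearMap.range D.excess).mkQ
    obtain ⟨c, hcw, hcb⟩ := D.exists_eq_const_of_ends
      (fun v => π (Pi.single v 1, 0)) (fun v => -π (0, Pi.single v 1)) (fun e => by
        rw [eq_neg_iff_add_eq_zero, ← map_add]
        refine (Submodule.Quotient.mk_eq_zero _).2 ⟨(Pi.single e 1, 0), ?_⟩
        ext v
        · simp [excess, Pi.single_apply, eq_comm]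
        · simp [excess, Pi.single_apply, eq_comm])
    have hab' : ∑ v, a v - ∑ v, b v = 0 := hab
    have h1 : ((a, b) : (D.White → ℤ) × (D.Black → ℤ)) =
        ∑ v, a v • (Pi.single v 1, 0) + ∑ v, b v • (0, Pi.single v 1) := by
      ext v
      · simp [Prod.fst_sum, Finset.sum_apply, Pi.single_apply]
      · simp [Prod.snd_sum, Finset.sum_apply, Pi.single_apply]
    have hcb' : ∀ v, π (0, Pi.single v 1) = -c := fun v => by rw [← hcb v, neg_neg]
    have h2 : π (a, b) = 0 := by
      rw [h1, map_add, map_sum, map_sum]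
      simp only [map_smul]
      rw [Finset.sum_congr rfl fun v _ => congrArg (a v • ·) (hcw v),
        Finset.sum_congr rfl fun v _ => congrArg (b v • ·) (hcb' v), ← Finset.sum_smul,
        ← Finset.sum_smul, smul_neg, ← sub_eq_add_neg, ← sub_smul, hab', zero_smul]
    exact (Submodule.Quotient.mk_eq_zero _).1 h2

lemma finrank_range_add_finrank_ker_int {M N : Type*} [AddCommGroup M] [AddCommGroup N]
    [Module.Finite ℤ M] (f : M →ₗ[ℤ] N) :
    Module.finrank ℤ (LinearMap.range f) + Module.finrank ℤ (LinearMap.ker f) =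
      Module.finrank ℤ M := by
  rw [← f.quotKerEquivRange.finrank_eq, Submodule.finrank_quotient_add_finrank]

/-- The lattice of the weightings with equal sums at all vertices has rank
`|E| + 1 - (V - 1) = g + 2`. -/
lemma finrank_ker_excess (hc : Fintype.card D.White = Fintype.card D.Black) :
    Module.finrank ℤ (LinearMap.ker D.excess) = D.numGaugeGroups + 2 := by
  have h1 := finrank_range_add_finrank_ker_int D.excess
  have h2 := finrank_range_add_finrank_ker_int D.imbalance
  have h3 : LinearMap.range D.imbalance = ⊤ := by
    rw [LinearMap.range_eq_top]
    intro d
    obtain ⟨v⟩ := (inferInstance : Nonempty D.White)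
    exact ⟨(Pi.single v d, 0), by simp [imbalance]⟩
  rw [range_excess _ hc] at h1
  rw [h3, finrank_top, Module.finrank_self, Module.finrank_prod, Module.finrank_pi,
    Module.finrank_pi, card_white_add_card_black] at h2
  rw [Module.finrank_prod, Module.finrank_pi, Module.finrank_self, ← D.card_edges] at h1
  omega

/-- The kernel of `excess` is a direct summand, as the image is free; so every functional on it
extends, and is given by integers on the edges. -/
lemma exists_extend_ker_excess (ℓ : LinearMap.ker D.excess →ₗ[ℤ] ℤ) :
    ∃ x : E → ℤ, ∀ z : LinearMap.ker D.excess, ∑ e, x e * z.1.1 e = ℓ z := by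
  obtain ⟨s, hs⟩ := Module.projective_lifting_property D.excess.rangeRestrict LinearMap.id
    D.excess.surjective_rangeRestrict
  have hs' : ∀ y, D.excess (s y) = y := fun y => congrArg Subtype.val (LinearMap.congr_fun hs y)
  let ρ : (E → ℤ) × ℤ →ₗ[ℤ] LinearMap.ker D.excess :=
    (LinearMap.id - s ∘ₗ D.excess.rangeRestrict).codRestrict _ fun z => by
      simp [LinearMap.mem_ker, hs']
  have hρ : ∀ z : LinearMap.ker D.excess, ρ z.1 = z := by
    intro z
    ext1
    have : D.excess.rangeRestrict z.1 = 0 := Subtype.ext z.2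
    simp [ρ, this]
  obtain ⟨v⟩ := (inferInstance : Nonempty D.White)
  let F := ℓ ∘ₗ ρ
  refine ⟨fun e => F (Pi.single e 1, 0) + (if D.whiteEnd e = v then F (0, 1) else 0), fun z => ?_⟩
  have hz := (D.mem_ker_excess.1 z.2).1 v
  have h1 : z.1 = ∑ e, z.1.1 e • ((Pi.single e 1, 0) : (E → ℤ) × ℤ) + z.1.2 • (0, 1) := by
    ext e
    · simp [Prod.fst_sum, Finset.sum_apply, Pi.single_apply]
    · simp [Prod.snd_sum]
  have h2 : F z.1 = ∑ e, z.1.1 e * F (Pi.single e 1, 0) + z.1.2 * F (0, 1) := by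
    conv_lhs => rw [h1]
    rw [map_add, map_sum]
    simp only [map_smul, smul_eq_mul]
  have h3 : F z.1 = ℓ z := congrArg ℓ (hρ z)
  rw [← h3, h2, ← hz, Finset.sum_mul, Finset.sum_filter, ← Finset.sum_add_distrib]
  refine Finset.sum_congr rfl fun e _ => ?_
  by_cases h : D.whiteEnd e = v
  · simp only [h, if_true]
    ring
  · simp only [h, if_false]
    ring

/-- A weighting whose sums at all vertices agree is an integral combination of perfect matchings:
after adding a multiple of the sum of all perfect matchings, which is positive on every edge, it is
a regular bipartite multigraph. -/
lemma exists_sum_matching_of_mem_ker (hD : D.IsNondegenerate) {z : (E → ℤ) × ℤ}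
    (hz : z ∈ LinearMap.ker D.excess) :
    ∃ c : D.PerfectMatching → ℤ, ∀ e, z.1 e = ∑ m, c m * D.matchingMatrix e m := by
  obtain ⟨hw, hb⟩ := D.mem_ker_excess.1 hz
  obtain ⟨f, d⟩ := z
  simp only at hw hb ⊢
  set k : ℤ := ∑ e, |f e|
  have hpos : ∀ e, 0 ≤ f e + ∑ m, k * D.matchingMatrix e m := by
    intro e
    obtain ⟨m, hm⟩ := hD e
    have h1 : |f e| ≤ k := Finset.single_le_sum (f := fun e => |f e|) (fun e _ => abs_nonneg _)
      (Finset.mem_univ e)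
    have h2 : k * D.matchingMatrix e m ≤ ∑ m, k * D.matchingMatrix e m :=
      Finset.single_le_sum (f := fun m => k * D.matchingMatrix e m) (fun m _ => by
        have : 0 ≤ k := Finset.sum_nonneg fun e _ => abs_nonneg _
        rw [matchingMatrix_apply]
        split_ifs <;> simp [this]) (Finset.mem_univ m)
    rw [matchingMatrix_apply, if_pos hm, mul_one] at h2
    linarith [neg_abs_le (f e)]
  choose F hF using fun e => Int.eq_ofNat_of_zero_le (hpos e)
  have hw' : ∀ v, ∑ e with D.whiteEnd e = v, (F e : ℤ) =
      d + k * Fintype.card D.PerfectMatching := by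
    intro v
    rw [Finset.sum_congr rfl fun e _ => (hF e).symm, Finset.sum_add_distrib, hw, Finset.sum_comm]
    simp only [matchingMatrix_apply, mul_ite, mul_one, mul_zero, sum_star_white]
    simp [mul_comm]
  have hb' : ∀ v, ∑ e with D.blackEnd e = v, (F e : ℤ) =
      d + k * Fintype.card D.PerfectMatching := by
    intro v
    rw [Finset.sum_congr rfl fun e _ => (hF e).symm, Finset.sum_add_distrib, hb, Finset.sum_comm]
    simp only [matchingMatrix_apply, mul_ite, mul_one, mul_zero, sum_star_black]
    simp [mul_comm]
  obtain ⟨c, hc⟩ := D.exists_sum_matching_of_regular hD.card_white_eq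
    (d + k * Fintype.card D.PerfectMatching).toNat F
    (fun v => by rw [← hw' v]; exact_mod_cast (Int.toNat_natCast _).symm)
    (fun v => by rw [← hb' v]; exact_mod_cast (Int.toNat_natCast _).symm)
  refine ⟨fun m => c m - k, fun e => ?_⟩
  have h1 := hF e
  rw [hc e] at h1
  push_cast at h1
  simp only [sub_mul, Finset.sum_sub_distrib]
  rw [eq_sub_iff_add_eq, h1]
  simp [matchingMatrix_apply]

/-- The matrices `K` and `T` of the toric description: in a basis of the lattice of the weightings
with equal sums at all vertices, `T` gives the coordinates of the perfect matchings and `K` the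
values on the edges. -/
theorem exists_toric_matrices (hD : D.IsNondegenerate) :
    ∃ (K : Matrix (Fin (D.numGaugeGroups + 2)) E ℤ)
      (T : Matrix (Fin (D.numGaugeGroups + 2)) D.PerfectMatching ℤ),
      Kᵀ * T = D.matchingMatrix ∧ Submodule.span ℤ (Set.range K.col) = ⊤ ∧
        Submodule.span ℤ (Set.range T.col) = ⊤ := by
  let B := Module.finBasisOfFinrankEq ℤ (LinearMap.ker D.excess)
    (D.finrank_ker_excess hD.card_white_eq)
  have hP : ∀ m : D.PerfectMatching,
      ((fun e => D.matchingMatrix e m, 1) : (E → ℤ) × ℤ) ∈ LinearMap.ker D.excess := by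
    intro m
    rw [mem_ker_excess]
    simp only [matchingMatrix_apply, sum_star_white, sum_star_black, implies_true, and_self]
  refine ⟨Matrix.of fun i e => (B i).1.1 e, Matrix.of fun i m => B.repr ⟨_, hP m⟩ i, ?_, ?_, ?_⟩
  · ext e m
    have := congrArg (fun z : LinearMap.ker D.excess => z.1.1 e) (B.sum_repr ⟨_, hP m⟩)
    simp only [Submodule.coe_sum, Submodule.coe_smul, Prod.fst_sum, Finset.sum_apply, Prod.smul_fst,
      Pi.smul_apply, smul_eq_mul] at this
    rw [Matrix.mul_apply, ← this]
    exact Finset.sum_congr rfl fun i _ => mul_comm _ _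
  · rw [eq_top_iff]
    rintro u -
    obtain ⟨x, hx⟩ := D.exists_extend_ker_excess (B.constr ℤ u)
    rw [Submodule.mem_span_range_iff_exists_fun]
    refine ⟨x, ?_⟩
    ext i
    have := hx (B i)
    rw [B.constr_basis] at this
    rw [← this]
    simp [Finset.sum_apply, Matrix.col]
  · rw [eq_top_iff]
    rintro u -
    obtain ⟨c, hc⟩ := D.exists_sum_matching_of_mem_ker hD (B.equivFun.symm u).2
    rw [Submodule.mem_span_range_iff_exists_fun]
    refine ⟨c, ?_⟩
    have h1 : B.equivFun.symm u = ∑ m, c m • (⟨_, hP m⟩ : LinearMap.ker D.excess) := by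
      obtain ⟨v⟩ := (inferInstance : Nonempty D.White)
      have h0 : (B.equivFun.symm u).1.1 = (∑ m, c m • (⟨_, hP m⟩ : LinearMap.ker D.excess)).1.1 := by
        ext e
        rw [hc e]
        simp [Prod.fst_sum, Finset.sum_apply]
      refine Subtype.ext (Prod.ext h0 ?_)
      rw [← (D.mem_ker_excess.1 (B.equivFun.symm u).2).1 v,
        ← (D.mem_ker_excess.1 (∑ m, c m • (⟨_, hP m⟩ : LinearMap.ker D.excess)).2).1 v, h0]
    have h2 := congrArg B.equivFun h1
    rw [LinearEquiv.apply_symm_apply, map_sum] at h2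
    rw [h2]
    refine Finset.sum_congr rfl fun m _ => ?_
    rw [map_smul]
    rfl

/-- A weighting that vanishes on all perfect matchings comes from a potential on the vertices with
total value zero. -/
lemma exists_potential_of_sum_eq_zero (hD : D.IsNondegenerate) {x : E → ℤ}
    (hx : ∀ m : D.PerfectMatching, ∑ e ∈ m.1, x e = 0) :
    ∃ (a : D.White → ℤ) (b : D.Black → ℤ), ∑ v, a v + ∑ v, b v = 0 ∧
      ∀ e, x e = a (D.whiteEnd e) + b (D.blackEnd e) := by
  obtain ⟨a, b, m, hab, hm⟩ := D.exists_tight_potential hD.card_white_eq hD.nonempty_matching x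
  have hs : ∑ v, a v + ∑ v, b v = 0 := by
    rw [← hx m, ← D.sum_matching_white m, ← D.sum_matching_black m, ← Finset.sum_add_distrib]
    exact Finset.sum_congr rfl hm
  refine ⟨a, b, hs, fun e => ?_⟩
  obtain ⟨m', he⟩ := hD e
  have h0 : ∑ e ∈ m'.1, (x e - (a (D.whiteEnd e) + b (D.blackEnd e))) = 0 := by
    rw [Finset.sum_sub_distrib, hx, Finset.sum_add_distrib, D.sum_matching_white,
      D.sum_matching_black, hs, sub_zero]
  have := (Finset.sum_eq_zero_iff_of_nonneg fun e _ => sub_nonneg.2 (hab e)).1 h0 e he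
  linarith

lemma sum_potential_smul {G : Type*} [AddCommGroup G] {g : E → G} {y : G}
    (hw : ∀ v, ∑ e with D.whiteEnd e = v, g e = y) (hb : ∀ v, ∑ e with D.blackEnd e = v, g e = y)
    (a : D.White → ℤ) (b : D.Black → ℤ) :
    ∑ e, (a (D.whiteEnd e) + b (D.blackEnd e)) • g e = (∑ v, a v + ∑ v, b v) • y := by
  simp only [add_smul, Finset.sum_add_distrib, Finset.sum_smul]
  congr 1
  · rw [← D.sum_sum_white]
    refine Finset.sum_congr rfl fun v _ => ?_
    rw [← hw v, Finset.smul_sum]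
    exact Finset.sum_congr rfl fun e he => by rw [(Finset.mem_filter.1 he).2]
  · rw [← D.sum_sum_black]
    refine Finset.sum_congr rfl fun v _ => ?_
    rw [← hb v, Finset.smul_sum]
    exact Finset.sum_congr rfl fun e he => by rw [(Finset.mem_filter.1 he).2]

/-- A family of group elements with the same sum at every vertex satisfies all the relations that
hold among the rows of the matching matrix. -/
lemma sum_smul_eq_zero (hD : D.IsNondegenerate) {G : Type*} [AddCommGroup G] {g : E → G} {y : G}
    (hw : ∀ v, ∑ e with D.whiteEnd e = v, g e = y) (hb : ∀ v, ∑ e with D.blackEnd e = v, g e = y)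
    {x : E → ℤ} (hx : ∀ m : D.PerfectMatching, ∑ e ∈ m.1, x e = 0) : ∑ e, x e • g e = 0 := by
  obtain ⟨a, b, hab, h⟩ := D.exists_potential_of_sum_eq_zero hD hx
  rw [Finset.sum_congr rfl fun e _ => congrArg (· • g e) (h e), D.sum_potential_smul hw hb, hab,
    zero_smul]

/-- A monomial with integral exponents that are non-negative on all perfect matchings may be
rewritten with non-negative exponents: subtracting an optimal potential makes the exponents
non-negative, and its total value is returned to the edges at a single vertex. -/
lemma exists_nonneg_of_sum_nonneg (hD : D.IsNondegenerate) {x : E → ℤ}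
    (hx : ∀ m : D.PerfectMatching, 0 ≤ ∑ e ∈ m.1, x e) :
    ∃ y : E → ℕ, ∀ m : D.PerfectMatching, ∑ e ∈ m.1, (y e : ℤ) = ∑ e ∈ m.1, x e := by
  obtain ⟨a, b, m₀, hab, hm₀⟩ := D.exists_tight_potential hD.card_white_eq hD.nonempty_matching x
  have hs : 0 ≤ ∑ v, a v + ∑ v, b v := by
    have := hx m₀
    rwa [← Finset.sum_congr rfl hm₀, Finset.sum_add_distrib, D.sum_matching_white,
      D.sum_matching_black] at this
  obtain ⟨v₀⟩ := (inferInstance : Nonempty D.White)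
  have hnn : ∀ e, 0 ≤ x e - (a (D.whiteEnd e) + b (D.blackEnd e)) +
      if D.whiteEnd e = v₀ then ∑ v, a v + ∑ v, b v else 0 := by
    intro e
    refine add_nonneg (sub_nonneg.2 (hab e)) ?_
    split_ifs
    · exact hs
    · exact le_rfl
  choose y hy using fun e => Int.eq_ofNat_of_zero_le (hnn e)
  refine ⟨y, fun m => ?_⟩
  rw [Finset.sum_congr rfl fun e _ => (hy e).symm, Finset.sum_add_distrib, Finset.sum_sub_distrib,
    Finset.sum_add_distrib, D.sum_matching_white, D.sum_matching_black,
    D.sum_matching_white m fun v => if v = v₀ then ∑ v, a v + ∑ v, b v else 0]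
  simp

section ToricMatrices

variable {D} {n : ℕ} {K : Matrix (Fin n) E ℤ} {T : Matrix (Fin n) D.PerfectMatching ℤ}

lemma col_dotProduct_col (hKT : Kᵀ * T = D.matchingMatrix) (e : E) (m : D.PerfectMatching) :
    K.col e ⬝ᵥ T.col m = if e ∈ m.1 then 1 else 0 := by
  rw [← matchingMatrix_apply, ← hKT]
  rfl

lemma sum_col_dotProduct_col (hKT : Kᵀ * T = D.matchingMatrix) (x : E → ℤ)
    (m : D.PerfectMatching) : (∑ e, x e • K.col e) ⬝ᵥ T.col m = ∑ e ∈ m.1, x e := by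
  rw [sum_dotProduct, ← sum_mul_matchingMatrix]
  refine Finset.sum_congr rfl fun e _ => ?_
  rw [smul_dotProduct, col_dotProduct_col hKT, matchingMatrix_apply, smul_eq_mul]

lemma eq_zero_of_dotProduct_col (hT : Submodule.span ℤ (Set.range T.col) = ⊤) {u : Fin n → ℤ}
    (hu : ∀ m, u ⬝ᵥ T.col m = 0) : u = 0 := by
  refine dotProduct_eq_zero _ fun w => ?_
  have hw : w ∈ Submodule.span ℤ (Set.range T.col) := hT ▸ Submodule.mem_top
  induction hw using Submodule.span_induction with
  | mem w hw =>
    obtain ⟨m, rfl⟩ := hw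
    exact hu m
  | zero => exact dotProduct_zero _
  | add w w' _ _ h h' => rw [dotProduct_add, h, h', add_zero]
  | smul c w _ h => rw [dotProduct_smul, h, smul_zero]

lemma sum_smul_col_eq_zero_iff (hKT : Kᵀ * T = D.matchingMatrix)
    (hT : Submodule.span ℤ (Set.range T.col) = ⊤) (x : E → ℤ) :
    ∑ e, x e • K.col e = 0 ↔ ∀ m : D.PerfectMatching, ∑ e ∈ m.1, x e = 0 := by
  constructor
  · intro h m
    rw [← sum_col_dotProduct_col hKT, h, zero_dotProduct]
  · intro h
    exact eq_zero_of_dotProduct_col hT fun m => by rw [sum_col_dotProduct_col hKT, h]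

/-- The degrees of all vertex monomials agree, and pair to one with every perfect matching. -/
lemma exists_vertex_degree (hKT : Kᵀ * T = D.matchingMatrix)
    (hT : Submodule.span ℤ (Set.range T.col) = ⊤) :
    ∃ u : Fin n → ℤ, (∀ m, u ⬝ᵥ T.col m = 1) ∧ (∀ v, ∑ e with D.whiteEnd e = v, K.col e = u) ∧
      ∀ v, ∑ e with D.blackEnd e = v, K.col e = u := by
  have hw : ∀ v m, (∑ e with D.whiteEnd e = v, K.col e) ⬝ᵥ T.col m = 1 := by
    intro v m
    rw [sum_dotProduct, Finset.sum_congr rfl fun e _ => col_dotProduct_col hKT e m,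
      D.sum_star_white]
  have hb : ∀ v m, (∑ e with D.blackEnd e = v, K.col e) ⬝ᵥ T.col m = 1 := by
    intro v m
    rw [sum_dotProduct, Finset.sum_congr rfl fun e _ => col_dotProduct_col hKT e m,
      D.sum_star_black]
  obtain ⟨v₀⟩ := (inferInstance : Nonempty D.White)
  refine ⟨_, hw v₀, fun v => ?_, fun v => ?_⟩ <;>
    refine sub_eq_zero.1 (eq_zero_of_dotProduct_col hT fun m => ?_)
  · rw [sub_dotProduct, hw, hw, sub_self]
  · rw [sub_dotProduct, hw, hb, sub_self]

lemma exists_sum_nsmul_col_eq (hD : D.IsNondegenerate) (hKT : Kᵀ * T = D.matchingMatrix)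
    (hK : Submodule.span ℤ (Set.range K.col) = ⊤) (hT : Submodule.span ℤ (Set.range T.col) = ⊤)
    {u : Fin n → ℤ} (hu : u ∈ dualSemigroup T) : ∃ y : E → ℕ, ∑ e, y e • K.col e = u := by
  obtain ⟨x, rfl⟩ := (Submodule.mem_span_range_iff_exists_fun ℤ).1
    (hK ▸ Submodule.mem_top : u ∈ Submodule.span ℤ (Set.range K.col))
  obtain ⟨y, hy⟩ := D.exists_nonneg_of_sum_nonneg hD (x := x) (fun m => by
    rw [← sum_col_dotProduct_col hKT]
    exact hu m)
  refine ⟨y, sub_eq_zero.1 (eq_zero_of_dotProduct_col hT fun m => ?_)⟩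
  have := sum_col_dotProduct_col hKT (fun e => (y e : ℤ)) m
  simp only [natCast_zsmul] at this
  rw [sub_dotProduct, this, sum_col_dotProduct_col hKT, hy, sub_self]

/-- The columns of `K` generate the semigroup of the dual cone. -/
theorem closure_col_eq_dualSemigroup (hD : D.IsNondegenerate) (hKT : Kᵀ * T = D.matchingMatrix)
    (hK : Submodule.span ℤ (Set.range K.col) = ⊤) (hT : Submodule.span ℤ (Set.range T.col) = ⊤) :
    AddSubmonoid.closure (Set.range K.col) = dualSemigroup T := by
  apply le_antisymm
  · rw [AddSubmonoid.closure_le]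
    rintro _ ⟨e, rfl⟩ m
    rw [col_dotProduct_col hKT]
    split_ifs <;> simp
  · intro u hu
    obtain ⟨y, rfl⟩ := exists_sum_nsmul_col_eq hD hKT hK hT hu
    have hmem : ∀ e, K.col e ∈ AddSubmonoid.closure (Set.range K.col) := fun e =>
      AddSubmonoid.subset_closure ⟨e, rfl⟩
    exact sum_mem fun e _ => nsmul_mem (hmem e) _

lemma exists_mem_notMem_of_ne {m m' : D.PerfectMatching} (h : m' ≠ m) :
    ∃ e ∈ m'.1, e ∉ m.1 := by
  by_contra! hcon
  refine h (Subtype.ext (Finset.eq_of_subset_of_card_le hcon ?_))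
  rw [D.card_matching_white, D.card_matching_white]

/-- No perfect matching lies in the cone generated by the others: the number of edges outside a
perfect matching `a`, reduced by one, is negative on `a` and non-negative on all others. -/
theorem col_notMem_columnCone (hKT : Kᵀ * T = D.matchingMatrix)
    (hT : Submodule.span ℤ (Set.range T.col) = ⊤) (a : D.PerfectMatching) :
    (fun i => (T i a : ℝ)) ∉ columnCone T {a}ᶜ := by
  obtain ⟨u₀, hu₀, -⟩ := exists_vertex_degree hKT hT
  set u : Fin n → ℤ := ∑ e with e ∉ a.1, K.col e - u₀ with hu
  have hval : ∀ m : D.PerfectMatching, u ⬝ᵥ T.col m =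
      ((Finset.univ.filter fun e => e ∉ a.1 ∧ e ∈ m.1).card : ℤ) - 1 := by
    intro m
    rw [hu, sub_dotProduct, hu₀, sum_dotProduct,
      Finset.sum_congr rfl fun e _ => col_dotProduct_col hKT e m, ← Finset.sum_filter,
      Finset.filter_filter]
    simp
  have hcast : ∀ m : D.PerfectMatching,
      (fun i => (u i : ℝ)) ⬝ᵥ (fun i => (T i m : ℝ)) = ((u ⬝ᵥ T.col m : ℤ) : ℝ) := by
    intro m
    simp [dotProduct, Matrix.col]
  have hcone : ∀ w ∈ columnCone T {a}ᶜ, 0 ≤ (fun i => (u i : ℝ)) ⬝ᵥ w := by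
    intro w hw
    unfold columnCone at hw
    induction hw using Submodule.span_induction with
    | mem w hw =>
      obtain ⟨m, hm, rfl⟩ := hw
      obtain ⟨e, he, he'⟩ := exists_mem_notMem_of_ne (m := a) (m' := m) hm
      rw [hcast, hval]
      have : 0 < (Finset.univ.filter fun e => e ∉ a.1 ∧ e ∈ m.1).card :=
        Finset.card_pos.2 ⟨e, by simp [he, he']⟩
      have : (1 : ℤ) ≤ ((Finset.univ.filter fun e => e ∉ a.1 ∧ e ∈ m.1).card : ℤ) := by
        exact_mod_cast this
      exact_mod_cast sub_nonneg.2 this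
    | zero => rw [dotProduct_zero]
    | add w w' _ _ h h' => rw [dotProduct_add]; exact add_nonneg h h'
    | smul c w _ h =>
      rw [show (c • w : Fin n → ℝ) = (c : ℝ) • w from rfl, dotProduct_smul]
      exact mul_nonneg c.2 h
  intro hmem
  have := hcone _ hmem
  rw [hcast, hval] at this
  have h0 : (Finset.univ.filter fun e => e ∉ a.1 ∧ e ∈ a.1) = ∅ :=
    Finset.filter_eq_empty_iff.2 fun e _ h => h.1 h.2
  rw [h0] at this
  norm_num at this

end ToricMatrices

end TorusDimer

/-! ### Dimension of affine varieties and multiplicative relations -/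

section Dimension

variable {k : Type*} [Field k]

/-- The Krull dimension is preserved by injective integral extensions: lying over and going up
lift chains of primes, and incomparability keeps chains strict under contraction. -/
theorem ringKrullDim_eq_of_injective_isIntegral {R S : Type*} [CommRing R] [CommRing S]
    [Algebra R S] [Algebra.IsIntegral R S] (h : Function.Injective (algebraMap R S)) :
    ringKrullDim S = ringKrullDim R := by
  apply le_antisymm
  · refine Order.krullDim_le_of_strictMono (PrimeSpectrum.comap (algebraMap R S)) ?_
    intro p q hpq
    exact Ideal.IsIntegral.comap_lt_comap (R := R) (I := p.asIdeal) (J := q.asIdeal) hpq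
  · refine iSup_le fun l => ?_
    obtain ⟨Q, -, hQ, hQ'⟩ := Ideal.exists_ideal_over_prime_of_isIntegral l.head.asIdeal
      (⊥ : Ideal S) (by
        intro x hx
        rw [Ideal.mem_comap, Ideal.mem_bot, map_eq_zero_iff _ h] at hx
        rw [hx]
        exact zero_mem _)
    have : Algebra.HasGoingUp R S := Algebra.HasGoingUp.of_isIntegral
    have : Q.LiesOver l.head.asIdeal := ⟨hQ'.symm⟩
    obtain ⟨L, hL, -⟩ := Ideal.exists_ltSeries_of_hasGoingUp l Q
    exact le_iSup_of_le L (by rw [hL])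

/-- The dimension of an affine variety is the transcendence degree of its coordinate ring. -/
theorem exists_ringKrullDim_eq_and_trdeg_eq (A : Type*) [CommRing A] [IsDomain A] [Algebra k A]
    [Algebra.FiniteType k A] : ∃ d : ℕ, ringKrullDim A = d ∧ Algebra.trdeg k A = d := by
  obtain ⟨d, g, hg, hint⟩ := exists_integral_inj_algHom_of_fg k A
  algebraize [g.toRingHom]
  have : Algebra.IsIntegral (MvPolynomial (Fin d) k) A := ⟨hint⟩
  refine ⟨d, ?_, ?_⟩
  · rw [ringKrullDim_eq_of_injective_isIntegral (R := MvPolynomial (Fin d) k) hg,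
      MvPolynomial.ringKrullDim_of_isNoetherianRing, ringKrullDim_eq_zero_of_field]
    simp
  · have : IsScalarTower k (MvPolynomial (Fin d) k) A := IsScalarTower.of_algHom g
    have : FaithfulSMul (MvPolynomial (Fin d) k) A := (faithfulSMul_iff_algebraMap_injective _ _).2 hg
    have h := (IsTranscendenceBasis.mvPolynomial (Fin d) k).algebraMap_comp (A := A)
    have := h.lift_cardinalMk_eq_trdeg
    simpa using this.symm

lemma card_le_ringKrullDim_of_algebraicIndependent {A : Type*} [CommRing A] [IsDomain A]
    [Algebra k A] [Algebra.FiniteType k A] {ι : Type*} [Fintype ι] {x : ι → A}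
    (hx : AlgebraicIndependent k x) : (Fintype.card ι : WithBot ℕ∞) ≤ ringKrullDim A := by
  obtain ⟨d, hd, hd'⟩ := exists_ringKrullDim_eq_and_trdeg_eq (k := k) A
  have := hx.lift_cardinalMk_le_trdeg
  rw [hd', Cardinal.mk_fintype, Cardinal.lift_natCast, Cardinal.lift_natCast, Nat.cast_le] at this
  rw [hd]
  exact_mod_cast this

lemma exists_algebraicIndependent_card_eq_ringKrullDim {A : Type*} [CommRing A] [IsDomain A]
    [Algebra k A] {E : Type*} [Fintype E] {x : E → A}
    (hx : Algebra.adjoin k (Set.range x) = ⊤) :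
    ∃ S : Finset E, AlgebraicIndependent k (fun s : S => x s) ∧
      ringKrullDim A = (S.card : ℕ) := by
  have : Algebra.FiniteType k A := ⟨⟨Finset.univ.image x, by simpa using hx⟩⟩
  obtain ⟨d, hd, hd'⟩ := exists_ringKrullDim_eq_and_trdeg_eq (k := k) A
  have : Algebra.IsAlgebraic (Algebra.adjoin k (Set.range x)) A := by
    refine ⟨fun a => ?_⟩
    have : a ∈ Algebra.adjoin k (Set.range x) := hx ▸ Algebra.mem_top
    exact isAlgebraic_algebraMap (⟨a, this⟩ : Algebra.adjoin k (Set.range x))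
  obtain ⟨t, ht, hbasis⟩ := exists_isTranscendenceBasis_subset (R := k) (Set.range x)
  choose s hs using fun a : t => ht a.2
  have hinj : Function.Injective s := fun a b h => Subtype.ext (by rw [← hs a, ← hs b, h])
  have : Finite t := Finite.of_injective s hinj
  have : Fintype t := Fintype.ofFinite t
  refine ⟨Finset.univ.image s, ?_, ?_⟩
  · let f : {e // e ∈ Finset.univ.image s} → t :=
      fun e => ⟨x e, by
        obtain ⟨a, -, ha⟩ := Finset.mem_image.1 e.2
        rw [← ha, hs]
        exact a.2⟩
    refine hbasis.1.comp f ?_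
    intro e e' h
    obtain ⟨a, -, ha⟩ := Finset.mem_image.1 e.2
    obtain ⟨b, -, hb⟩ := Finset.mem_image.1 e'.2
    have h' : x e = x e' := congrArg Subtype.val h
    rw [← ha, ← hb, hs, hs] at h'
    exact Subtype.ext (by rw [← ha, ← hb, Subtype.ext h'])
  · have := hbasis.lift_cardinalMk_eq_trdeg
    rw [hd', Cardinal.mk_fintype, Cardinal.lift_natCast, Cardinal.lift_natCast, Nat.cast_inj] at this
    rw [hd, Finset.card_image_of_injective _ hinj, Finset.card_univ, this]

/-- Algebraically independent elements satisfy no non-trivial multiplicative relation. -/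
lemma AlgebraicIndependent.eq_zero_of_prod_zpow_eq_one {A F : Type*} [CommRing A] [Field F]
    [Algebra A F] [FaithfulSMul A F] [Algebra k A] {ι : Type*} [Fintype ι] {x : ι → A}
    (hx : AlgebraicIndependent k x) {y : ι → ℤ}
    (hy : ∏ i, algebraMap A F (x i) ^ y i = 1) : y = 0 := by
  have hinj := FaithfulSMul.algebraMap_injective A F
  have : Nontrivial A := RingHom.domain_nontrivial (algebraMap A F)
  have hne : ∀ i, algebraMap A F (x i) ≠ 0 := fun i => by
    rw [Ne, map_eq_zero_iff _ hinj]
    exact hx.ne_zero i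
  let p : ι →₀ ℕ := Finsupp.equivFunOnFinite.symm fun i => (y i).toNat
  let q : ι →₀ ℕ := Finsupp.equivFunOnFinite.symm fun i => (-y i).toNat
  have hpq : ∏ i, x i ^ p i = ∏ i, x i ^ q i := by
    apply hinj
    simp only [map_prod, map_pow]
    have : ∀ i, algebraMap A F (x i) ^ p i =
        algebraMap A F (x i) ^ y i * algebraMap A F (x i) ^ q i := by
      intro i
      rw [← zpow_natCast, ← zpow_natCast, ← zpow_add₀ (hne i)]
      congr 1
      simp only [p, q, Finsupp.equivFunOnFinite_symm_apply_apply]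
      omega
    rw [Finset.prod_congr rfl fun i _ => this i, Finset.prod_mul_distrib, hy, one_mul]
  have h : MvPolynomial.monomial p (1 : k) = MvPolynomial.monomial q 1 := by
    apply hx
    rw [MvPolynomial.aeval_monomial, MvPolynomial.aeval_monomial,
      Finsupp.prod_fintype _ _ (by simp), Finsupp.prod_fintype _ _ (by simp), hpq]
  have h' : p = q := MvPolynomial.monomial_left_injective one_ne_zero h
  ext i
  have := DFunLike.congr_fun h' i
  simp only [p, q, Finsupp.equivFunOnFinite_symm_apply_apply] at this
  rw [Pi.zero_apply]
  omega

/-- Every independent multiplicative relation among generators lowers the bound for the dimension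
by one; a generator that vanishes may be given any exponent. -/
theorem ringKrullDim_add_card_le_of_relations {A : Type*} [CommRing A] [IsDomain A]
    [Algebra k A] {E : Type*} [Fintype E] {x : E → A}
    (hx : Algebra.adjoin k (Set.range x) = ⊤) {κ : Type*} [Fintype κ] {r : κ → E → ℤ}
    (hr : LinearIndependent ℤ r)
    (hrel : ∀ j, ∏ e with x e ≠ 0, algebraMap A (FractionRing A) (x e) ^ r j e = 1) :
    ringKrullDim A + (Fintype.card κ : ℕ) ≤ (Fintype.card E : ℕ) := by
  obtain ⟨S, hS, hd⟩ := exists_algebraicIndependent_card_eq_ringKrullDim hx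
  have hne : ∀ e, x e ≠ 0 → algebraMap A (FractionRing A) (x e) ≠ 0 := fun e h =>
    (map_ne_zero_iff _ (IsFractionRing.injective A (FractionRing A))).2 h
  have hspan : ∀ y ∈ Submodule.span ℤ (Set.range r),
      ∏ e with x e ≠ 0, algebraMap A (FractionRing A) (x e) ^ y e = 1 := by
    intro y hy
    induction hy using Submodule.span_induction with
    | mem y hy =>
      obtain ⟨j, rfl⟩ := hy
      exact hrel j
    | zero => simp
    | add y z _ _ hy hz =>
      rw [← mul_one (1 : FractionRing A)]
      nth_rw 1 [← hy]
      rw [← hz, ← Finset.prod_mul_distrib]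
      exact Finset.prod_congr rfl fun e he => zpow_add₀ (hne e (Finset.mem_filter.1 he).2) _ _
    | smul c y _ hy =>
      simp only [Pi.smul_apply, smul_eq_mul, mul_comm c, zpow_mul]
      rw [Finset.prod_zpow, hy, one_zpow]
  have hsupp : ∀ y ∈ Submodule.span ℤ (Set.range fun s : S => (Pi.single (s : E) 1 : E → ℤ)),
      ∀ e ∉ S, y e = 0 := by
    intro y hy e he
    induction hy using Submodule.span_induction with
    | mem y hy =>
      obtain ⟨s, rfl⟩ := hy
      exact Pi.single_eq_of_ne (fun h : e = s => he (h ▸ s.2)) _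
    | zero => rfl
    | add y z _ _ hy hz => rw [Pi.add_apply, hy, hz, add_zero]
    | smul c y _ hy => rw [Pi.smul_apply, hy, smul_zero]
  have hli : LinearIndependent ℤ (Sum.elim (fun s : S => (Pi.single (s : E) 1 : E → ℤ)) r) := by
    refine LinearIndependent.sum_type ?_ hr ?_
    · have := (Pi.basisFun ℤ E).linearIndependent.comp (fun s : S => (s : E))
        Subtype.val_injective
      have h : (fun s : S => (Pi.single (s : E) 1 : E → ℤ)) =
          Pi.basisFun ℤ E ∘ fun s : S => (s : E) := by
        ext s
        simp
      rw [h]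
      exact this
    · rw [Submodule.disjoint_def]
      intro y hy hy'
      have h0 := hsupp y hy
      have h1 : ∏ s : S, algebraMap A (FractionRing A) (x s) ^ y s = 1 := by
        rw [← hspan y hy']
        rw [Finset.prod_coe_sort S fun e => algebraMap A (FractionRing A) (x e) ^ y e]
        refine Finset.prod_subset ?_ ?_
        · intro e he
          have := hS.ne_zero ⟨e, he⟩
          simpa using this
        · intro e _ he
          rw [h0 e he, zpow_zero]
      have h2 := hS.eq_zero_of_prod_zpow_eq_one h1
      ext e
      by_cases he : e ∈ S
      · exact congrFun h2 ⟨e, he⟩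
      · exact h0 e he
  have hcard := hli.fintype_card_le_finrank
  rw [Module.finrank_pi, Fintype.card_sum, Fintype.card_coe] at hcard
  rw [hd]
  exact_mod_cast hcard

end Dimension

/-! ### The F-terms, and components on which a field vanishes -/

namespace TorusDimer

open MvPolynomial

lemma pderiv_prod_X {E : Type*} (e : E) (s : Finset E) :
    pderiv e (∏ f ∈ s, X f : MvPolynomial E ℂ) = if e ∈ s then ∏ f ∈ s.erase e, X f else 0 := by
  induction s using Finset.induction_on with
  | empty => simp
  | insert a s ha ih =>
    rw [Finset.prod_insert ha, Derivation.leibniz, ih, pderiv_X]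
    by_cases hae : e = a
    · subst hae
      simp [ha]
    · have : a ∉ s.erase e := fun h => ha (Finset.mem_of_mem_erase h)
      rw [Pi.single_eq_of_ne (Ne.symm hae), smul_zero, add_zero]
      by_cases he : e ∈ s
      · simp [he, Finset.erase_insert_of_ne (Ne.symm hae), Finset.prod_insert this]
      · simp [he, hae]

lemma prod_erase_ne_zero_iff {E A : Type*} [CommRing A] [IsDomain A] {x : E → A} {s : Finset E}
    {e : E} :
    ∏ f ∈ s.erase e, x f ≠ 0 ↔ ∀ f, x f = 0 → f ∈ s → f = e := by
  rw [Finset.prod_ne_zero_iff]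
  refine forall_congr' fun f => ⟨fun h h0 hs => ?_, fun h hf h0 => ?_⟩
  · by_contra hne
    exact h (Finset.mem_erase.2 ⟨hne, hs⟩) h0
  · exact (Finset.mem_erase.1 hf).1 (h h0 (Finset.mem_erase.1 hf).2)

lemma prod_zpow_ite {E F : Type*} [Field F] (z : E → F) (p : E → Prop) (s : Finset E) :
    ∏ f ∈ s, z f ^ (if p f then (1 : ℤ) else 0) = ∏ f ∈ s with p f, z f := by
  rw [Finset.prod_filter]
  refine Finset.prod_congr rfl fun f _ => ?_
  split_ifs <;> simp

/-- If the zeros of `x` meet every fibre of `w`, and `p` holds for those that are alone in their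
fibre, then counting the zeros together with the elements that satisfy `p` gives at least two for
every fibre. -/
lemma two_mul_card_le {E W A : Type*} [Fintype E] [Fintype W] [Zero A] {x : E → A} (w : E → W)
    (p : E → Prop)
    (hcover : ∀ v, ∃ e, x e = 0 ∧ w e = v)
    (hp : ∀ e, x e = 0 → (∀ f, x f = 0 → w f = w e → f = e) → p e) :
    2 * Fintype.card W ≤ Fintype.card {e // x e = 0} + (Finset.univ.filter fun e => p e).card := by
  have h1 : ∀ v : W, 2 ≤ ∑ e with w e = v, ((if x e = 0 then 1 else 0) + if p e then 1 else 0) := by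
    intro v
    obtain ⟨e, he, rfl⟩ := hcover v
    by_cases h : ∀ f, x f = 0 → w f = w e → f = e
    · refine le_trans ?_ (Finset.single_le_sum (f := fun e => (if x e = 0 then 1 else 0) +
        if p e then 1 else 0) (fun _ _ => Nat.zero_le _) (show e ∈ _ by simp))
      simp [he, hp e he h]
    · push Not at h
      obtain ⟨f, hf, hwf, hne⟩ := h
      have := Finset.add_le_sum (f := fun e => (if x e = 0 then 1 else 0) +
        if p e then 1 else 0) (s := Finset.univ.filter fun f => w f = w e)
        (fun _ _ => Nat.zero_le _) (show f ∈ _ by simp [hwf]) (show e ∈ _ by simp) hne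
      refine le_trans ?_ this
      simp only [hf, he, if_true]
      omega
  have h2 := Finset.sum_le_sum fun v (_ : v ∈ Finset.univ) => h1 v
  have h3 : ∑ v, ∑ e with w e = v, ((if x e = 0 then 1 else 0) + if p e then 1 else 0) =
      ∑ e, ((if x e = 0 then 1 else 0) + if p e then 1 else 0) := by
    convert Finset.sum_fiberwise Finset.univ w fun e =>
      (if x e = 0 then 1 else 0) + if p e then 1 else 0
  rw [h3, Finset.sum_add_distrib] at h2
  simp only [Finset.sum_const, Finset.card_univ, smul_eq_mul, Finset.sum_boole, Nat.cast_id] at h2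
  rw [Fintype.card_subtype]
  omega

variable {E : Type*} [Fintype E] (D : TorusDimer E)

lemma pderiv_superpotential (e : E) : pderiv e D.superpotential =
    ∏ f ∈ (Finset.univ.filter fun f => D.whiteEnd f = D.whiteEnd e).erase e, X f -
      ∏ f ∈ (Finset.univ.filter fun f => D.blackEnd f = D.blackEnd e).erase e, X f := by
  unfold superpotential
  rw [map_sub, map_sum, map_sum]
  congr 1
  · rw [Finset.sum_eq_single (D.whiteEnd e)]
    · rw [pderiv_prod_X, if_pos (by simp)]
    · intro v _ hv
      rw [pderiv_prod_X, if_neg (by simpa using Ne.symm hv)]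
    · simp
  · rw [Finset.sum_eq_single (D.blackEnd e)]
    · rw [pderiv_prod_X, if_pos (by simp)]
    · intro v _ hv
      rw [pderiv_prod_X, if_neg (by simpa using Ne.symm hv)]
    · simp

/-- The F-term equations for a family of elements of a ring, one for each edge. -/
def FTerms {A : Type*} [CommRing A] (x : E → A) : Prop :=
  ∀ e, ∏ f ∈ (Finset.univ.filter fun f => D.whiteEnd f = D.whiteEnd e).erase e, x f =
    ∏ f ∈ (Finset.univ.filter fun f => D.blackEnd f = D.blackEnd e).erase e, x f

lemma fTermIdeal_le_ker_iff {A : Type*} [CommRing A] [Algebra ℂ A]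
    (φ : MvPolynomial E ℂ →ₐ[ℂ] A) :
    D.fTermIdeal ≤ RingHom.ker φ ↔ D.FTerms fun e => φ (X e) := by
  unfold fTermIdeal FTerms
  rw [Ideal.span_le, Set.range_subset_iff]
  refine forall_congr' fun e => ?_
  rw [SetLike.mem_coe, RingHom.mem_ker, pderiv_superpotential, map_sub, map_prod, map_prod,
    sub_eq_zero]

variable {D}

/-- By connectedness, all vertex monomials agree on the master space. -/
lemma FTerms.exists_vertex_eq {A : Type*} [CommRing A] {x : E → A} (hx : D.FTerms x) :
    ∃ y, (∀ v, ∏ e with D.whiteEnd e = v, x e = y) ∧ ∀ v, ∏ e with D.blackEnd e = v, x e = y :=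
  D.exists_eq_const_of_ends _ _ fun e => by
    rw [← Finset.mul_prod_erase _ x (a := e) (by simp), hx e,
      Finset.mul_prod_erase _ x (a := e) (by simp)]

section Isolated

variable {A : Type*} [CommRing A] [IsDomain A] {x : E → A}

variable (D) in
/-- An edge whose field vanishes, with no other vanishing field at its white end. -/
def IsIsolatedZero (x : E → A) (e : E) : Prop :=
  x e = 0 ∧ ∀ f, x f = 0 → D.whiteEnd f = D.whiteEnd e → f = e

/-- A vanishing field is the only one at its white end exactly if it is the only one at its black
end, since the two sides of its F-term vanish together. -/
lemma FTerms.isIsolatedZero_iff (hx : D.FTerms x) {e : E} : D.IsIsolatedZero x e ↔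
    x e = 0 ∧ ∀ f, x f = 0 → D.blackEnd f = D.blackEnd e → f = e := by
  have h1 := prod_erase_ne_zero_iff (x := x) (e := e)
    (s := Finset.univ.filter fun f => D.whiteEnd f = D.whiteEnd e)
  have h2 := prod_erase_ne_zero_iff (x := x) (e := e)
    (s := Finset.univ.filter fun f => D.blackEnd f = D.blackEnd e)
  rw [hx e, h2] at h1
  simp only [Finset.mem_filter, Finset.mem_univ, true_and] at h1
  unfold IsIsolatedZero
  rw [h1]

/-- The relations on a stratum where some fields vanish: the vanishing fields, and the ratio of
the two sides of the F-term of every isolated vanishing field but one. -/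
def stratumRelation (x : E → A) (e₀ : E) :
    {e // x e = 0} ⊕ {e // D.IsIsolatedZero x e ∧ e ≠ e₀} → E → ℤ :=
  Sum.elim (fun e => Pi.single e.1 1) fun e f =>
    (if D.whiteEnd f = D.whiteEnd e then 1 else 0) - if D.blackEnd f = D.blackEnd e then 1 else 0

lemma FTerms.stratumRelation_eq_one (hx : D.FTerms x) (e₀ : E) (j) :
    ∏ f with x f ≠ 0, algebraMap A (FractionRing A) (x f) ^ D.stratumRelation x e₀ j f = 1 := by
  have hne : ∀ e, x e ≠ 0 → algebraMap A (FractionRing A) (x e) ≠ 0 := fun e h =>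
    (map_ne_zero_iff _ (IsFractionRing.injective A (FractionRing A))).2 h
  rcases j with e | e
  · refine Finset.prod_eq_one fun f hf => ?_
    have : f ≠ e.1 := fun h => (Finset.mem_filter.1 hf).2 (h ▸ e.2)
    simp [stratumRelation, Pi.single_eq_of_ne this]
  · simp only [stratumRelation, Sum.elim_inr]
    rw [Finset.prod_congr rfl fun f hf => zpow_sub₀ (hne f (Finset.mem_filter.1 hf).2) _ _,
      Finset.prod_div_distrib, prod_zpow_ite, prod_zpow_ite, div_eq_one_iff_eq]
    · have hw : Finset.filter (fun f => D.whiteEnd f = D.whiteEnd e.1)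
          (Finset.univ.filter fun f => x f ≠ 0) =
          (Finset.univ.filter fun f => D.whiteEnd f = D.whiteEnd e.1).erase e.1 := by
        ext f
        simp only [Finset.mem_filter, Finset.mem_univ, true_and, Finset.mem_erase]
        exact ⟨fun h => ⟨fun hf => h.1 (hf ▸ e.2.1.1), h.2⟩,
          fun h => ⟨fun h0 => h.1 (e.2.1.2 f h0 h.2), h.2⟩⟩
      have hb : Finset.filter (fun f => D.blackEnd f = D.blackEnd e.1)
          (Finset.univ.filter fun f => x f ≠ 0) =
          (Finset.univ.filter fun f => D.blackEnd f = D.blackEnd e.1).erase e.1 := by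
        ext f
        simp only [Finset.mem_filter, Finset.mem_univ, true_and, Finset.mem_erase]
        exact ⟨fun h => ⟨fun hf => h.1 (hf ▸ e.2.1.1), h.2⟩,
          fun h => ⟨fun h0 => h.1 ((hx.isIsolatedZero_iff.1 e.2.1).2 f h0 h.2), h.2⟩⟩
      rw [hw, hb, ← map_prod, ← map_prod, hx]
    · rw [Finset.prod_ne_zero_iff]
      intro f hf
      exact hne f (Finset.mem_filter.1 (Finset.mem_filter.1 hf).1).2

/-- The relations on a stratum are independent: the coefficients of the F-terms in a dependence sum
to functions on the white and on the black vertices that agree along every edge, so by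
connectedness these are constant, and the constant is zero because `e₀` is left out. -/
lemma FTerms.linearIndependent_stratumRelation (hx : D.FTerms x) {e₀ : E} (h₀ : x e₀ = 0) :
    LinearIndependent ℤ (D.stratumRelation x e₀) := by
  rw [Fintype.linearIndependent_iff]
  intro c hc
  -- the coefficients of the F-terms, which give a function on the vertices with isolated zeros
  set d : E → ℤ := fun e =>
    if h : D.IsIsolatedZero x e ∧ e ≠ e₀ then c (Sum.inr ⟨e, h⟩) else 0 with hd
  have hd0 : ∀ e, ¬ (D.IsIsolatedZero x e ∧ e ≠ e₀) → d e = 0 := fun e h => dif_neg h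
  have heval : ∀ f, (if h : x f = 0 then c (Sum.inl ⟨f, h⟩) else 0) +
      (∑ e with D.whiteEnd e = D.whiteEnd f, d e -
        ∑ e with D.blackEnd e = D.blackEnd f, d e) = 0 := by
    intro f
    have h1 := congrFun hc f
    rw [Fintype.sum_sum_type, Pi.add_apply, Finset.sum_apply, Finset.sum_apply] at h1
    have h2 : ∑ e : {e // x e = 0}, (c (Sum.inl e) • D.stratumRelation x e₀ (Sum.inl e)) f =
        if h : x f = 0 then c (Sum.inl ⟨f, h⟩) else 0 := by
      split_ifs with h
      · rw [Finset.sum_eq_single ⟨f, h⟩]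
        · simp [stratumRelation]
        · intro e _ he
          have : f ≠ e.1 := fun h => he (Subtype.ext h.symm)
          simp [stratumRelation, Pi.single_eq_of_ne this]
        · simp
      · refine Finset.sum_eq_zero fun e _ => ?_
        have : f ≠ e.1 := fun h' => h (h' ▸ e.2)
        simp [stratumRelation, Pi.single_eq_of_ne this]
    have h3 : ∑ e : {e // D.IsIsolatedZero x e ∧ e ≠ e₀},
        (c (Sum.inr e) • D.stratumRelation x e₀ (Sum.inr e)) f =
        ∑ e with D.whiteEnd e = D.whiteEnd f, d e -
          ∑ e with D.blackEnd e = D.blackEnd f, d e := by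
      have h4 : ∀ e : {e // D.IsIsolatedZero x e ∧ e ≠ e₀},
          (c (Sum.inr e) • D.stratumRelation x e₀ (Sum.inr e)) f =
          (fun e => d e * ((if D.whiteEnd e = D.whiteEnd f then 1 else 0) -
            if D.blackEnd e = D.blackEnd f then 1 else 0)) e.1 := by
        intro e
        simp only [hd, dif_pos e.2, stratumRelation, Sum.elim_inr, Pi.smul_apply, smul_eq_mul,
          eq_comm]
      rw [Finset.sum_congr rfl fun e _ => h4 e, ← Finset.sum_subtype
        (Finset.univ.filter fun e => D.IsIsolatedZero x e ∧ e ≠ e₀) (by simp)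
        fun e => d e * ((if D.whiteEnd e = D.whiteEnd f then 1 else 0) -
          if D.blackEnd e = D.blackEnd f then 1 else 0),
        Finset.sum_subset (Finset.filter_subset _ _) fun e _ he => by
          rw [hd0 e fun h => he (by simpa using h), zero_mul]]
      simp only [mul_sub, Finset.sum_sub_distrib, mul_ite, mul_one, mul_zero, Finset.sum_filter]
    rw [h2, h3, Pi.zero_apply] at h1
    exact h1
  have hw0 : ∀ f, x f = 0 → ¬ (D.IsIsolatedZero x f ∧ f ≠ e₀) →
      ∑ e with D.whiteEnd e = D.whiteEnd f, d e = 0 := by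
    intro f hf hf'
    refine Finset.sum_eq_zero fun e he => hd0 e fun h => hf' ?_
    rwa [h.1.2 f hf (Finset.mem_filter.1 he).2.symm]
  have hb0 : ∀ f, x f = 0 → ¬ (D.IsIsolatedZero x f ∧ f ≠ e₀) →
      ∑ e with D.blackEnd e = D.blackEnd f, d e = 0 := by
    intro f hf hf'
    refine Finset.sum_eq_zero fun e he => hd0 e fun h => hf' ?_
    rwa [(hx.isIsolatedZero_iff.1 h.1).2 f hf (Finset.mem_filter.1 he).2.symm]
  have hw1 : ∀ f, D.IsIsolatedZero x f → ∑ e with D.whiteEnd e = D.whiteEnd f, d e = d f := by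
    intro f hf
    refine Finset.sum_eq_single f (fun e he hne => hd0 e fun h => hne ?_) (by simp)
    exact hf.2 e h.1.1 (Finset.mem_filter.1 he).2
  have hb1 : ∀ f, D.IsIsolatedZero x f → ∑ e with D.blackEnd e = D.blackEnd f, d e = d f := by
    intro f hf
    refine Finset.sum_eq_single f (fun e he hne => hd0 e fun h => hne ?_) (by simp)
    exact (hx.isIsolatedZero_iff.1 hf).2 e h.1.1 (Finset.mem_filter.1 he).2
  obtain ⟨a, haw, -⟩ := D.exists_eq_const_of_ends
    (fun v => ∑ e with D.whiteEnd e = v, d e) (fun v => ∑ e with D.blackEnd e = v, d e) (by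
    intro f
    by_cases hf : x f = 0
    · by_cases hi : D.IsIsolatedZero x f
      · exact (hw1 f hi).trans (hb1 f hi).symm
      · exact (hw0 f hf fun h => hi h.1).trans (hb0 f hf fun h => hi h.1).symm
    · have := heval f
      rw [dif_neg hf, zero_add, sub_eq_zero] at this
      exact this)
  have ha : a = 0 := by
    rw [← haw (D.whiteEnd e₀)]
    exact hw0 e₀ h₀ fun h => h.2 rfl
  have hdzero : ∀ e, d e = 0 := by
    intro e
    by_cases h : D.IsIsolatedZero x e ∧ e ≠ e₀
    · rw [← hw1 e h.1, ← ha]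
      exact haw _
    · exact hd0 e h
  rintro (e | e)
  · have := heval e.1
    simp only [hdzero, Finset.sum_const_zero, sub_self, add_zero] at this
    rwa [dif_pos e.2] at this
  · have := hdzero e.1
    simp only [hd] at this
    rwa [dif_pos e.2] at this

/-- A component of the master space on which some field vanishes has dimension at most `g + 1`.
All vertex monomials vanish, so a field vanishes at every vertex; hence the number of vanishing
fields plus the number of isolated ones is at least `V`, while the independent relations on the
stratum number one less. -/
theorem FTerms.ringKrullDim_le_of_eq_zero [Algebra ℂ A] (hx : D.FTerms x)
    (hgen : Algebra.adjoin ℂ (Set.range x) = ⊤) {e₀ : E} (h₀ : x e₀ = 0) :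
    ringKrullDim A ≤ (D.numGaugeGroups + 1 : ℕ) := by
  have hdim := ringKrullDim_add_card_le_of_relations hgen
    (hx.linearIndependent_stratumRelation h₀) (hx.stratumRelation_eq_one e₀)
  obtain ⟨S, -, hS⟩ := exists_algebraicIndependent_card_eq_ringKrullDim hgen
  rw [hS] at hdim ⊢
  have hdim' : S.card + Fintype.card
      ({e // x e = 0} ⊕ {e // D.IsIsolatedZero x e ∧ e ≠ e₀}) ≤ Fintype.card E := by
    exact_mod_cast hdim
  obtain ⟨y, hyw, hyb⟩ := hx.exists_vertex_eq
  have hy : y = 0 := by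
    rw [← hyw (D.whiteEnd e₀)]
    exact Finset.prod_eq_zero (by simp) h₀
  have hw := two_mul_card_le (x := x) D.whiteEnd (D.IsIsolatedZero x) (fun v => by
    obtain ⟨e, he, he0⟩ := Finset.prod_eq_zero_iff.1 ((hyw v).trans hy)
    exact ⟨e, he0, (Finset.mem_filter.1 he).2⟩) (fun e he h => ⟨he, h⟩)
  have hb := two_mul_card_le (x := x) D.blackEnd (D.IsIsolatedZero x) (fun v => by
    obtain ⟨e, he, he0⟩ := Finset.prod_eq_zero_iff.1 ((hyb v).trans hy)
    exact ⟨e, he0, (Finset.mem_filter.1 he).2⟩) (fun e he h => hx.isIsolatedZero_iff.2 ⟨he, h⟩)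
  have hcard : (Finset.univ.filter fun e => D.IsIsolatedZero x e).card ≤
      Fintype.card {e // D.IsIsolatedZero x e ∧ e ≠ e₀} + 1 := by
    rw [Fintype.card_subtype]
    refine le_trans (Finset.card_le_card (t := insert e₀
      (Finset.univ.filter fun e => D.IsIsolatedZero x e ∧ e ≠ e₀)) fun e he => ?_)
      (Finset.card_insert_le _ _)
    by_cases h : e = e₀
    · simp [h]
    · exact Finset.mem_insert_of_mem (by simpa [h] using he)
  rw [Fintype.card_sum, ← D.card_edges, ← D.card_white_add_card_black] at hdim'
  exact_mod_cast (by omega : S.card ≤ D.numGaugeGroups + 1)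

end Isolated

end TorusDimer

/-! ### The matching map and its ring of invariants -/

namespace TorusDimer

open MvPolynomial

lemma adjoin_mk_X {E : Type*} (q : Ideal (MvPolynomial E ℂ)) :
    Algebra.adjoin ℂ (Set.range fun e => Ideal.Quotient.mk q (X e : MvPolynomial E ℂ)) = ⊤ := by
  have h : (Set.range fun e => Ideal.Quotient.mk q (X e : MvPolynomial E ℂ)) =
      Ideal.Quotient.mkₐ ℂ q '' Set.range X := by
    rw [← Set.range_comp]
    rfl
  rw [h, ← AlgHom.map_adjoin, adjoin_range_X, Algebra.map_top, AlgHom.range_eq_top]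
  exact Ideal.Quotient.mkₐ_surjective ℂ q

lemma prod_zpow_eq_zpow_sum {ι G : Type*} [CommGroup G] (s : Finset ι) (k : ι → ℤ) (g : G) :
    ∏ i ∈ s, g ^ k i = g ^ ∑ i ∈ s, k i := by
  induction s using Finset.induction_on with
  | empty => simp
  | insert a s ha ih => rw [Finset.prod_insert ha, ih, Finset.sum_insert ha, zpow_add]

variable {E : Type*} [Fintype E] (D : TorusDimer E)

/-- The exponents of the image of a monomial under `matchingMap`. -/
def matchingDegree (m : E →₀ ℕ) : D.PerfectMatching →₀ ℕ :=
  Finsupp.equivFunOnFinite.symm fun a => ∑ e ∈ a.1, m e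

@[simp]
lemma matchingDegree_apply (m : E →₀ ℕ) (a : D.PerfectMatching) :
    D.matchingDegree m a = ∑ e ∈ a.1, m e := rfl

lemma matchingMap_monomial (m : E →₀ ℕ) (c : ℂ) :
    D.matchingMap (monomial m c) = monomial (D.matchingDegree m) c := by
  unfold matchingMap
  rw [aeval_monomial, monomial_eq, algebraMap_eq, Finsupp.prod_fintype _ _ (by simp),
    Finsupp.prod_fintype _ _ (by simp)]
  congr 1
  have h1 : ∀ e, (∏ a : D.PerfectMatching with e ∈ a.1, X a : MvPolynomial D.PerfectMatching ℂ) ^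
      m e = ∏ a : D.PerfectMatching, if e ∈ a.1 then X a ^ m e else 1 := by
    intro e
    rw [← Finset.prod_pow, Finset.prod_filter]
  have h2 : ∀ a : D.PerfectMatching, (X a : MvPolynomial D.PerfectMatching ℂ) ^
      D.matchingDegree m a = ∏ e, if e ∈ a.1 then X a ^ m e else 1 := by
    intro a
    rw [matchingDegree_apply, ← Finset.prod_pow_eq_pow_sum, Finset.prod_ite_mem, Finset.univ_inter]
  rw [Finset.prod_congr rfl fun a _ => h2 a, Finset.prod_comm]
  exact Finset.prod_congr rfl fun e _ => h1 e

lemma matchingDegree_single (e : E) (a : D.PerfectMatching) :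
    D.matchingDegree (Finsupp.single e 1) a = if e ∈ a.1 then 1 else 0 := by
  simp [Finsupp.single_apply]

lemma matchingMap_X (e : E) :
    D.matchingMap (X e) = monomial (D.matchingDegree (Finsupp.single e 1)) 1 :=
  D.matchingMap_monomial _ _

lemma matchingMap_X_ne_zero (e : E) : D.matchingMap (X e) ≠ 0 := by
  rw [matchingMap_X, Ne, monomial_eq_zero]
  exact one_ne_zero

/-- As `matchingMap` sends monomials to monomials, a linear map vanishes on its kernel as soon as
its values on monomials depend on their degrees only. -/
lemma eq_zero_of_matchingMap_eq_zero {W : Type*} [AddCommGroup W] [Module ℂ W]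
    (ψ : MvPolynomial E ℂ →ₗ[ℂ] W)
    (hψ : ∀ m m', D.matchingDegree m = D.matchingDegree m' →
      ψ (monomial m 1) = ψ (monomial m' 1)) {f : MvPolynomial E ℂ} (hf : D.matchingMap f = 0) :
    ψ f = 0 := by
  let θ : MvPolynomial D.PerfectMatching ℂ →ₗ[ℂ] W :=
    (basisMonomials _ ℂ).constr ℂ fun d => ψ (monomial (Function.invFun D.matchingDegree d) 1)
  have h : θ ∘ₗ D.matchingMap.toLinearMap = ψ := by
    refine (basisMonomials E ℂ).ext fun m => ?_
    rw [LinearMap.comp_apply, AlgHom.toLinearMap_apply, coe_basisMonomials, matchingMap_monomial]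
    have := (basisMonomials D.PerfectMatching ℂ).constr_basis ℂ
      (fun d => ψ (monomial (Function.invFun D.matchingDegree d) 1)) (D.matchingDegree m)
    rw [coe_basisMonomials] at this
    exact this.trans (hψ _ _ (Function.invFun_eq ⟨m, rfl⟩))
  rw [← h, LinearMap.comp_apply, AlgHom.toLinearMap_apply, hf, map_zero]

/-- Non-zero field elements with the same product at every vertex satisfy all the multiplicative
relations among the fields on the coherent component. -/
lemma prod_zpow_eq_one (hD : D.IsNondegenerate) {F : Type*} [Field F] {x : E → F} {y : F}
    (hx : ∀ e, x e ≠ 0) (hw : ∀ v, ∏ e with D.whiteEnd e = v, x e = y)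
    (hb : ∀ v, ∏ e with D.blackEnd e = v, x e = y)
    {c : E → ℤ} (hc : ∀ m : D.PerfectMatching, ∑ e ∈ m.1, c e = 0) : ∏ e, x e ^ c e = 1 := by
  let g : E → Additive Fˣ := fun e => Additive.ofMul (Units.mk0 (x e) (hx e))
  have hsum : ∀ s : Finset E, ((∑ e ∈ s, g e).toMul : F) = ∏ e ∈ s, x e := by
    intro s
    rw [toMul_sum, Units.coe_prod]
    rfl
  obtain ⟨v₀⟩ := (inferInstance : Nonempty D.White)
  have := D.sum_smul_eq_zero hD (g := g) (y := ∑ e with D.whiteEnd e = v₀, g e)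
    (fun v => Additive.toMul.injective (Units.ext (by rw [hsum, hsum, hw, hw])))
    (fun v => Additive.toMul.injective (Units.ext (by rw [hsum, hsum, hw, hb]))) hc
  have h := congrArg (fun z : Additive Fˣ => (z.toMul : F)) this
  simp only [toMul_sum, toMul_zsmul, Units.coe_prod, Units.val_zpow_eq_zpow_val, toMul_zero,
    Units.val_one] at h
  exact h

lemma fTerms_matchingMap : D.FTerms fun e => D.matchingMap (X e) := by
  intro e
  have hw : ∀ v, ∏ e with D.whiteEnd e = v, D.matchingMap (X e) =
      monomial (Finsupp.equivFunOnFinite.symm fun _ => 1) 1 := by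
    intro v
    rw [Finset.prod_congr rfl fun e _ => D.matchingMap_X e, ← monomial_sum_one]
    refine congrArg (fun d => monomial d (1 : ℂ)) (Finsupp.ext fun a => ?_)
    rw [Finsupp.finsetSum_apply, Finset.sum_congr rfl fun e _ => D.matchingDegree_single e a,
      sum_star_white]
    rfl
  have hb : ∀ v, ∏ e with D.blackEnd e = v, D.matchingMap (X e) =
      monomial (Finsupp.equivFunOnFinite.symm fun _ => 1) 1 := by
    intro v
    rw [Finset.prod_congr rfl fun e _ => D.matchingMap_X e, ← monomial_sum_one]
    refine congrArg (fun d => monomial d (1 : ℂ)) (Finsupp.ext fun a => ?_)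
    rw [Finsupp.finsetSum_apply, Finset.sum_congr rfl fun e _ => D.matchingDegree_single e a,
      sum_star_black]
    rfl
  refine mul_left_cancel₀ (D.matchingMap_X_ne_zero e) ?_
  rw [Finset.mul_prod_erase _ (fun e => D.matchingMap (X e)) (by simp),
    Finset.mul_prod_erase _ (fun e => D.matchingMap (X e)) (by simp), hw, hb]

lemma fTermIdeal_le_ker_matchingMap : D.fTermIdeal ≤ RingHom.ker D.matchingMap :=
  (D.fTermIdeal_le_ker_iff _).2 D.fTerms_matchingMap

lemma fTerms_mk {q : Ideal (MvPolynomial E ℂ)} (hq : D.fTermIdeal ≤ q) :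
    D.FTerms fun e => Ideal.Quotient.mk q (X e) := by
  have := (D.fTermIdeal_le_ker_iff (Ideal.Quotient.mkₐ ℂ q)).1
    fun f hf => Ideal.Quotient.eq_zero_iff_mem.2 (hq hf)
  exact this

/-- Every component of the master space on which no field vanishes is contained in the coherent
one: in its function field all vertex monomials agree, so the fields satisfy the multiplicative
relations that hold among their images in `ℂ[p_1, …, p_c]`. -/
lemma ker_matchingMap_le (hD : D.IsNondegenerate) {q : Ideal (MvPolynomial E ℂ)} [q.IsPrime]
    (hq : D.fTermIdeal ≤ q) (hX : ∀ e, X e ∉ q) : RingHom.ker D.matchingMap ≤ q := by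
  intro f hf
  rw [RingHom.mem_ker] at hf
  rw [← Ideal.Quotient.eq_zero_iff_mem]
  obtain ⟨y, hw, hb⟩ := (D.fTerms_mk hq).exists_vertex_eq
  let ι := algebraMap (MvPolynomial E ℂ ⧸ q) (FractionRing (MvPolynomial E ℂ ⧸ q))
  have hι : Function.Injective ι := IsFractionRing.injective _ _
  have hne : ∀ e, ι (Ideal.Quotient.mk q (X e)) ≠ 0 := by
    intro e h
    rw [map_eq_zero_iff _ hι, Ideal.Quotient.eq_zero_iff_mem] at h
    exact hX e h
  refine D.eq_zero_of_matchingMap_eq_zero (Ideal.Quotient.mkₐ ℂ q).toLinearMap ?_ hf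
  intro m m' hm
  have hmon : ∀ m : E →₀ ℕ, ι (Ideal.Quotient.mk q (monomial m 1)) =
      ∏ e, ι (Ideal.Quotient.mk q (X e)) ^ (m e : ℤ) := by
    intro m
    rw [monomial_eq, map_one, one_mul, Finsupp.prod_fintype _ _ (by simp)]
    simp [map_prod]
  apply hι
  change ι (Ideal.Quotient.mk q (monomial m 1)) = ι (Ideal.Quotient.mk q (monomial m' 1))
  have h1 := D.prod_zpow_eq_one hD (y := ι y) hne
    (fun v => by rw [← map_prod, ← hw v])
    (fun v => by rw [← map_prod, ← hb v]) (c := fun e => (m e : ℤ) - m' e) (fun a => by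
      rw [Finset.sum_sub_distrib, sub_eq_zero]
      have := DFunLike.congr_fun hm a
      rw [matchingDegree_apply, matchingDegree_apply] at this
      exact_mod_cast this)
  simp only [zpow_sub₀ (hne _), Finset.prod_div_distrib] at h1
  rw [hmon, hmon]
  refine (div_eq_one_iff_eq ?_).1 h1
  exact Finset.prod_ne_zero_iff.2 fun e _ => zpow_ne_zero _ (hne e)

instance ker_matchingMap_isPrime : (RingHom.ker D.matchingMap).IsPrime := RingHom.ker_isPrime _

lemma ringKrullDim_quotient_le_of_X_mem {q : Ideal (MvPolynomial E ℂ)} [q.IsPrime]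
    (hq : D.fTermIdeal ≤ q) {e : E} (he : X e ∈ q) :
    ringKrullDim (MvPolynomial E ℂ ⧸ q) ≤ (D.numGaugeGroups + 1 : ℕ) :=
  (D.fTerms_mk hq).ringKrullDim_le_of_eq_zero (adjoin_mk_X q)
    (Ideal.Quotient.eq_zero_iff_mem.2 he)

/-- The kernel of `matchingMap` is the only component of largest dimension. -/
theorem isTopComponent_iff (hD : D.IsNondegenerate)
    (hdim : ringKrullDim (MvPolynomial E ℂ ⧸ RingHom.ker D.matchingMap) =
      (D.numGaugeGroups + 2 : ℕ)) (q : Ideal (MvPolynomial E ℂ)) :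
    D.IsTopComponent q ↔ q = RingHom.ker D.matchingMap := by
  have hX : ∀ e, X e ∉ RingHom.ker D.matchingMap := fun e => D.matchingMap_X_ne_zero e
  have hmin : RingHom.ker D.matchingMap ∈ D.fTermIdeal.minimalPrimes := by
    refine ⟨⟨inferInstance, D.fTermIdeal_le_ker_matchingMap⟩, fun q hq hle => ?_⟩
    have := hq.1
    exact D.ker_matchingMap_le hD hq.2 fun e he => hX e (hle he)
  have hcases : ∀ q ∈ D.fTermIdeal.minimalPrimes, q = RingHom.ker D.matchingMap ∨
      ringKrullDim (MvPolynomial E ℂ ⧸ q) ≤ (D.numGaugeGroups + 1 : ℕ) := by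
    intro q hq
    have := hq.1.1
    by_cases h : ∃ e, X e ∈ q
    · obtain ⟨e, he⟩ := h
      exact Or.inr (D.ringKrullDim_quotient_le_of_X_mem hq.1.2 he)
    · have hle := D.ker_matchingMap_le hD hq.1.2 fun e he => h ⟨e, he⟩
      exact Or.inl (le_antisymm (hq.2 hmin.1 hle) hle)
  have hlt : ((D.numGaugeGroups + 1 : ℕ) : WithBot ℕ∞) < (D.numGaugeGroups + 2 : ℕ) := by
    exact_mod_cast Nat.lt_succ_self _
  constructor
  · intro hq
    refine (hcases q hq.1).resolve_right fun h => ?_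
    have := hq.2 _ hmin
    rw [hdim] at this
    exact absurd (this.trans h) (not_le.2 hlt)
  · rintro rfl
    refine ⟨hmin, fun q hq => ?_⟩
    rcases hcases q hq with rfl | h
    · exact le_rfl
    · rw [hdim]
      exact h.trans hlt.le

section Quotient

variable {D}

/-- An integer functional on the perfect matchings that vanishes on the kernel of the matching
matrix is an integral combination of its rows. -/
lemma exists_sum_eq_of_kernel (hD : D.IsNondegenerate) {d : D.PerfectMatching → ℤ}
    (hd : ∀ v : D.PerfectMatching → ℤ, D.matchingMatrix *ᵥ v = 0 → ∑ a, d a * v a = 0) :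
    ∃ x : E → ℤ, ∀ a : D.PerfectMatching, ∑ e ∈ a.1, x e = d a := by
  obtain ⟨K, T, hKT, hK, hT⟩ := D.exists_toric_matrices hD
  choose c hc using fun i => (Submodule.mem_span_range_iff_exists_fun ℤ).1
    (hT ▸ Submodule.mem_top : (Pi.single i 1 : Fin (D.numGaugeGroups + 2) → ℤ) ∈
      Submodule.span ℤ (Set.range T.col))
  obtain ⟨x, hx⟩ := (Submodule.mem_span_range_iff_exists_fun ℤ).1
    (hK ▸ Submodule.mem_top : (fun i => ∑ a, d a * c i a : Fin (D.numGaugeGroups + 2) → ℤ) ∈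
      Submodule.span ℤ (Set.range K.col))
  refine ⟨x, fun a => ?_⟩
  rw [← sum_col_dotProduct_col hKT, hx]
  have hker : T *ᵥ (fun b => (if b = a then 1 else 0) - ∑ i, T i a * c i b) = 0 := by
    ext j
    have hcj : ∀ i, ∑ b, T j b * c i b = if j = i then 1 else 0 := by
      intro i
      have := congrFun (hc i) j
      simp only [Finset.sum_apply, Pi.smul_apply, smul_eq_mul, Matrix.col_apply] at this
      rw [Pi.single_apply] at this
      rw [← this]
      exact Finset.sum_congr rfl fun b _ => mul_comm _ _
    simp only [Matrix.mulVec, dotProduct, mul_sub, Finset.sum_sub_distrib, Finset.mul_sum]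
    rw [Finset.sum_comm]
    simp only [mul_left_comm (T j _), ← Finset.mul_sum, hcj]
    simp
  have := hd _ (by rw [← hKT, ← Matrix.mulVec_mulVec, hker, Matrix.mulVec_zero])
  simp only [mul_sub, Finset.sum_sub_distrib, Finset.mul_sum] at this
  rw [Finset.sum_comm, sub_eq_zero] at this
  simp only [mul_ite, mul_one, mul_zero, Finset.sum_ite_eq', Finset.mem_univ, if_true] at this
  rw [this]
  simp only [dotProduct, Matrix.col_apply, Finset.sum_mul]
  exact Finset.sum_congr rfl fun i _ => Finset.sum_congr rfl fun b _ => by ring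

lemma chargeAction_monomial {ι : Type*} [Fintype ι] {r : ℕ} (Q : Matrix ι (Fin r) ℤ)
    (t : Fin r → ℂˣ) (d : ι →₀ ℕ) (c : ℂ) : chargeAction Q t (monomial d c) =
      monomial d (((∏ i, t i ^ ∑ a, (d a : ℤ) * Q a i : ℂˣ) : ℂ) * c) := by
  unfold chargeAction
  rw [aeval_monomial, algebraMap_eq, Finsupp.prod_fintype _ _ (by simp)]
  simp only [mul_pow, Finset.prod_mul_distrib, ← map_pow, ← map_prod]
  rw [monomial_eq, Finsupp.prod_fintype _ _ (by simp), ← mul_assoc, ← C_mul, mul_comm c]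
  congr 3
  rw [Units.coe_prod]
  simp only [Units.coe_prod, ← Finset.prod_pow]
  rw [Finset.prod_comm]
  refine Finset.prod_congr rfl fun i _ => ?_
  simp only [← Units.val_pow_eq_pow_val]
  rw [← Units.coe_prod]
  congr 1
  rw [← prod_zpow_eq_zpow_sum]
  refine Finset.prod_congr rfl fun a _ => ?_
  rw [mul_comm, zpow_mul, zpow_natCast]

lemma coeff_chargeAction {ι : Type*} [Fintype ι] {r : ℕ} (Q : Matrix ι (Fin r) ℤ)
    (t : Fin r → ℂˣ) (d : ι →₀ ℕ) (f : MvPolynomial ι ℂ) : coeff d (chargeAction Q t f) =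
      ((∏ i, t i ^ ∑ a, (d a : ℤ) * Q a i : ℂˣ) : ℂ) * coeff d f := by
  induction f using MvPolynomial.induction_on' with
  | monomial d' c =>
    rw [chargeAction_monomial, coeff_monomial, coeff_monomial]
    split_ifs with h
    · rw [h]
    · rw [mul_zero]
  | add f g hf hg => rw [map_add, coeff_add, hf, hg, coeff_add, mul_add]

lemma mem_quotientRing {ι : Type*} {r : ℕ} {Q : Matrix ι (Fin r) ℤ} {f : MvPolynomial ι ℂ} :
    f ∈ quotientRing Q ↔ ∀ t, chargeAction Q t f = f := by
  unfold quotientRing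
  rw [Algebra.mem_iInf]
  rfl

/-- An invariant polynomial consists of monomials that are orthogonal to all vectors of charges. -/
lemma sum_mul_eq_zero_of_mem_quotientRing {ι : Type*} [Fintype ι] {r : ℕ}
    {Q : Matrix ι (Fin r) ℤ} {f : MvPolynomial ι ℂ} (hf : f ∈ quotientRing Q) {d : ι →₀ ℕ}
    (hd : coeff d f ≠ 0) (i : Fin r) : ∑ a, (d a : ℤ) * Q a i = 0 := by
  have h := coeff_chargeAction Q (Pi.mulSingle i (Units.mk0 2 two_ne_zero)) d f
  rw [mem_quotientRing.1 hf] at h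
  have h1 := mul_right_cancel₀ hd ((one_mul _).trans h)
  rw [Finset.prod_eq_single i, Pi.mulSingle_eq_same, Units.val_zpow_eq_zpow_val, Units.val_mk0]
    at h1
  · have h2 : (2 : ℝ) ^ (∑ a, (d a : ℤ) * Q a i) = 1 := by
      have := congrArg (fun z : ℂ => ‖z‖) h1
      simpa using this.symm
    exact (zpow_eq_one_iff_right₀ (by norm_num) (by norm_num)).1 h2
  · intro j _ hj
    rw [Pi.mulSingle_eq_of_ne hj, one_zpow]
  · simp

/-- The image of `matchingMap` is the ring of invariants: an invariant monomial is orthogonal to the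
kernel of the matching matrix, so it is a combination of its rows, and by Egerváry's theorem the
combination may be chosen non-negative. -/
theorem range_matchingMap_eq_quotientRing (hD : D.IsNondegenerate) {r : ℕ}
    {Q : Matrix D.PerfectMatching (Fin r) ℤ} (hQ : IsKernelMatrix D.matchingMatrix Q) :
    D.matchingMap.range = quotientRing Q := by
  have hcol : ∀ i, D.matchingMatrix *ᵥ Q.col i = 0 := by
    intro i
    have : Q.col i ∈ LinearMap.ker D.matchingMatrix.mulVecLin :=
      hQ.2 ▸ Submodule.subset_span ⟨i, rfl⟩
    exact this
  apply le_antisymm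
  · rintro _ ⟨f, rfl⟩
    rw [mem_quotientRing]
    intro t
    have : (chargeAction Q t).comp D.matchingMap = D.matchingMap := by
      refine MvPolynomial.algHom_ext fun e => ?_
      rw [AlgHom.comp_apply, matchingMap_X, chargeAction_monomial]
      congr 1
      rw [mul_one, Finset.prod_eq_one, Units.val_one]
      intro i _
      have h := congrFun (hcol i) e
      simp only [Matrix.mulVec, dotProduct, matchingMatrix_apply, Matrix.col_apply,
        Pi.zero_apply] at h
      have : ∀ a : D.PerfectMatching,
          ((D.matchingDegree (Finsupp.single e 1) a : ℕ) : ℤ) = if e ∈ a.1 then 1 else 0 := by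
        intro a
        rw [matchingDegree_single]
        push_cast
        rfl
      rw [Finset.sum_congr rfl fun a _ => congrArg (· * Q a i) (this a), h, zpow_zero]
    exact DFunLike.congr_fun this f
  · intro f hf
    rw [← f.support_sum_monomial_coeff]
    refine sum_mem fun d hd => ?_
    have hd' := sum_mul_eq_zero_of_mem_quotientRing hf (mem_support_iff.1 hd)
    obtain ⟨x, hx⟩ := exists_sum_eq_of_kernel hD (d := fun a => (d a : ℤ)) (fun v hv => by
      have hv' : v ∈ Submodule.span ℤ (Set.range Q.col) := by
        rw [hQ.2]
        exact hv
      clear hv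
      induction hv' using Submodule.span_induction with
      | mem v hv =>
        obtain ⟨i, rfl⟩ := hv
        exact hd' i
      | zero => simp
      | add v w _ _ h h' =>
        simp only [Pi.add_apply, mul_add, Finset.sum_add_distrib, h, h', add_zero]
      | smul c v _ h =>
        simp only [Pi.smul_apply, smul_eq_mul, mul_left_comm _ c, ← Finset.mul_sum, h, mul_zero])
    obtain ⟨y, hy⟩ := D.exists_nonneg_of_sum_nonneg hD (x := x) (fun m => by
      rw [hx]
      positivity)
    refine ⟨monomial (Finsupp.equivFunOnFinite.symm y) (coeff d f), ?_⟩
    change D.matchingMap _ = _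
    rw [matchingMap_monomial]
    refine congrArg (fun d' => monomial d' (coeff d f)) (Finsupp.ext fun a => ?_)
    rw [matchingDegree_apply]
    have := (hy a).trans (hx a)
    exact_mod_cast this

lemma exists_isKernelMatrix :
    ∃ (r : ℕ) (Q : Matrix D.PerfectMatching (Fin r) ℤ), IsKernelMatrix D.matchingMatrix Q := by
  let b := Module.finBasis ℤ (LinearMap.ker D.matchingMatrix.mulVecLin)
  let Q : Matrix D.PerfectMatching (Fin _) ℤ := Matrix.of fun a i => (b i).1 a
  have hQ : Q.col = (LinearMap.ker D.matchingMatrix.mulVecLin).subtype ∘ b := rfl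
  refine ⟨_, Q, ?_, ?_⟩
  · rw [hQ]
    exact b.linearIndependent.map' _ (Submodule.ker_subtype _)
  · rw [hQ, Set.range_comp, ← Submodule.map_span, b.span_eq, Submodule.map_top,
      Submodule.range_subtype]

/-- The coordinate ring of the coherent component is saturated in `ℂ[p_1, …, p_c]`, as a ring of
invariants. -/
lemma mem_range_matchingMap_of_mul_mem (hD : D.IsNondegenerate)
    {f c : MvPolynomial D.PerfectMatching ℂ} (hc : c ∈ D.matchingMap.range) (hc0 : c ≠ 0)
    (hfc : f * c ∈ D.matchingMap.range) : f ∈ D.matchingMap.range := by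
  obtain ⟨r, Q, hQ⟩ := exists_isKernelMatrix (D := D)
  rw [range_matchingMap_eq_quotientRing hD hQ, mem_quotientRing] at *
  intro t
  have := hfc t
  rw [map_mul, hc t] at this
  exact mul_right_cancel₀ hc0 this

/-- The rank of the matching matrix is `g + 2`: it has the kernel of `T`, whose columns generate
`ℤ^(g + 2)`. -/
lemma finrank_ker_matchingMatrix (hD : D.IsNondegenerate) :
    Module.finrank ℤ (LinearMap.ker D.matchingMatrix.mulVecLin) + (D.numGaugeGroups + 2) =
      Fintype.card D.PerfectMatching := by
  obtain ⟨K, T, hKT, hK, hT⟩ := D.exists_toric_matrices hD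
  have hker : LinearMap.ker D.matchingMatrix.mulVecLin = LinearMap.ker T.mulVecLin := by
    ext v
    rw [LinearMap.mem_ker, LinearMap.mem_ker, Matrix.mulVecLin_apply, Matrix.mulVecLin_apply,
      ← hKT, ← Matrix.mulVec_mulVec]
    constructor
    · intro h
      refine dotProduct_eq_zero _ fun w => ?_
      have hw : w ∈ Submodule.span ℤ (Set.range K.col) := hK ▸ Submodule.mem_top
      induction hw using Submodule.span_induction with
      | mem w hw =>
        obtain ⟨e, rfl⟩ := hw
        rw [dotProduct_comm]
        exact congrFun h e
      | zero => exact dotProduct_zero _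
      | add w w' _ _ h h' => rw [dotProduct_add, h, h', add_zero]
      | smul c w _ h => rw [dotProduct_smul, h, smul_zero]
    · intro h
      rw [h, Matrix.mulVec_zero]
  have h := finrank_range_add_finrank_ker_int T.mulVecLin
  rw [Matrix.range_mulVecLin, hT, finrank_top, Module.finrank_pi, Module.finrank_pi,
    Fintype.card_fin] at h
  rw [hker, ← h, add_comm]

lemma add_eq_card_of_isKernelMatrix (hD : D.IsNondegenerate) {r : ℕ}
    {Q : Matrix D.PerfectMatching (Fin r) ℤ} (hQ : IsKernelMatrix D.matchingMatrix Q) :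
    r + (D.numGaugeGroups + 2) = Fintype.card D.PerfectMatching := by
  rw [← finrank_ker_matchingMatrix hD, ← hQ.2, finrank_span_eq_card hQ.1, Fintype.card_fin]

/-- The charges are traceless, as the sum of the rows of the matching matrix at a vertex is
`(1, …, 1)`. -/
lemma one_vecMul_eq_zero {r : ℕ} {Q : Matrix D.PerfectMatching (Fin r) ℤ}
    (hQ : IsKernelMatrix D.matchingMatrix Q) : (1 : D.PerfectMatching → ℤ) ᵥ* Q = 0 := by
  ext i
  have hi : Q.col i ∈ LinearMap.ker D.matchingMatrix.mulVecLin :=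
    hQ.2 ▸ Submodule.subset_span ⟨i, rfl⟩
  obtain ⟨v⟩ := (inferInstance : Nonempty D.White)
  have h : ∑ e with D.whiteEnd e = v, (D.matchingMatrix *ᵥ Q.col i) e = 0 :=
    Finset.sum_eq_zero fun e _ => congrFun hi e
  simp only [Matrix.mulVec, dotProduct] at h
  rw [Finset.sum_comm] at h
  simp only [← Finset.sum_mul, matchingMatrix_apply, sum_star_white] at h
  simpa [Matrix.vecMul, dotProduct] using h

end Quotient

end TorusDimer

/-! ### The semigroup algebra, minors and dimension -/

namespace TorusDimer

open MvPolynomial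

variable {E : Type*} [Fintype E] {D : TorusDimer E}

section SemigroupAlgebra

variable {n : ℕ} {K : Matrix (Fin n) E ℤ} {T : Matrix (Fin n) D.PerfectMatching ℤ}

/-- The coherent component is the toric variety of the dual cone: the map that sends `X_e` to the
character `K_e` is onto as the columns of `K` generate the semigroup, and it has the kernel of
`matchingMap`, which it factors. -/
theorem exists_quotient_algEquiv (hD : D.IsNondegenerate) (hKT : Kᵀ * T = D.matchingMatrix)
    (hK : Submodule.span ℤ (Set.range K.col) = ⊤) (hT : Submodule.span ℤ (Set.range T.col) = ⊤) :
    ∃ φ : (MvPolynomial E ℂ ⧸ RingHom.ker D.matchingMap) ≃ₐ[ℂ]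
        AddMonoidAlgebra ℂ (dualSemigroup T),
      ∀ (e : E) (he : K.col e ∈ dualSemigroup T),
        φ (Ideal.Quotient.mk _ (X e)) = AddMonoidAlgebra.single ⟨K.col e, he⟩ 1 := by
  have hmem : ∀ e, K.col e ∈ dualSemigroup T := fun e =>
    closure_col_eq_dualSemigroup hD hKT hK hT ▸ AddSubmonoid.subset_closure ⟨e, rfl⟩
  let ψ : MvPolynomial E ℂ →ₐ[ℂ] AddMonoidAlgebra ℂ (dualSemigroup T) :=
    aeval fun e => AddMonoidAlgebra.single ⟨K.col e, hmem e⟩ 1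
  have hψ : ∀ m : E →₀ ℕ, ψ (monomial m 1) =
      AddMonoidAlgebra.single (∑ e, m e • (⟨K.col e, hmem e⟩ : dualSemigroup T)) 1 := by
    intro m
    simp only [ψ]
    rw [aeval_monomial, map_one, one_mul, Finsupp.prod_fintype _ _ (by simp)]
    simp only [AddMonoidAlgebra.single_pow, one_pow]
    rw [AddMonoidAlgebra.prod_single]
    simp
  have hsurj : Function.Surjective ψ := by
    intro z
    change z ∈ ψ.range
    induction z using AddMonoidAlgebra.induction_on with
    | of u =>
      obtain ⟨u, hu⟩ := u
      obtain ⟨y, rfl⟩ := exists_sum_nsmul_col_eq hD hKT hK hT hu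
      refine ⟨monomial (Finsupp.equivFunOnFinite.symm y) 1, ?_⟩
      refine (hψ _).trans ?_
      rw [AddMonoidAlgebra.of_apply]
      congr 1
      ext1
      simp
    | add x y hx hy => exact add_mem hx hy
    | smul c x hx => exact Subalgebra.smul_mem _ hx c
  -- the exponents of the character `u` on `ℂ^c`
  let deg : dualSemigroup T →+ (D.PerfectMatching →₀ ℕ) :=
    { toFun u := Finsupp.equivFunOnFinite.symm fun a => (u.1 ⬝ᵥ T.col a).toNat
      map_zero' := by
        ext a
        simp
      map_add' u v := by
        ext a
        simp only [Finsupp.equivFunOnFinite_symm_apply_apply, Finsupp.add_apply,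
          AddSubmonoid.coe_add, add_dotProduct]
        exact Int.toNat_add (u.2 a) (v.2 a) }
  let j : AddMonoidAlgebra ℂ (dualSemigroup T) →ₐ[ℂ] MvPolynomial D.PerfectMatching ℂ :=
    AddMonoidAlgebra.lift ℂ _ _
      { toFun u := monomial (deg u.toAdd) 1
        map_one' := by
          rw [toAdd_one, map_zero]
          rfl
        map_mul' u v := by rw [toAdd_mul, map_add, monomial_mul, one_mul] }
  have hj : j.comp ψ = D.matchingMap := by
    refine MvPolynomial.algHom_ext fun e => ?_
    rw [AlgHom.comp_apply, matchingMap_X]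
    simp only [ψ, j, aeval_X, AddMonoidAlgebra.lift_single, one_smul]
    refine congrArg (fun d => monomial d (1 : ℂ)) (Finsupp.ext fun a => ?_)
    rw [matchingDegree_single]
    change ((K.col e) ⬝ᵥ T.col a).toNat = _
    rw [col_dotProduct_col hKT]
    split_ifs <;> rfl
  have hker : RingHom.ker D.matchingMap = RingHom.ker ψ := by
    apply le_antisymm
    · intro f hf
      refine D.eq_zero_of_matchingMap_eq_zero ψ.toLinearMap (fun m m' hm => ?_) hf
      change ψ _ = ψ _
      rw [hψ, hψ]
      congr 1
      ext1
      rw [AddSubmonoid.coe_finsetSum, AddSubmonoid.coe_finsetSum]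
      refine sub_eq_zero.1 (eq_zero_of_dotProduct_col hT fun a => ?_)
      have h : ∀ m : E →₀ ℕ, (∑ e, ((m e • (⟨K.col e, hmem e⟩ : dualSemigroup T) :
          dualSemigroup T) : Fin n → ℤ)) ⬝ᵥ T.col a = D.matchingDegree m a := by
        intro m
        have := sum_col_dotProduct_col hKT (fun e => (m e : ℤ)) a
        simp only [natCast_zsmul] at this
        rw [matchingDegree_apply]
        push_cast
        exact this
      rw [sub_dotProduct, h, h, hm, sub_self]
    · intro f hf
      rw [RingHom.mem_ker] at hf ⊢
      rw [← hj, AlgHom.comp_apply, hf, map_zero]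
  refine ⟨(Ideal.quotientEquivAlgOfEq ℂ hker).trans
    (Ideal.quotientKerAlgEquivOfSurjective hsurj), fun e he => ?_⟩
  rw [AlgEquiv.trans_apply, Ideal.quotientEquivAlgOfEq_mk]
  exact (Ideal.quotientKerAlgEquivOfSurjective_apply hsurj _).trans (aeval_X _ e)

end SemigroupAlgebra

section Minors

variable {n : ℕ} {K : Matrix (Fin n) E ℤ} {T : Matrix (Fin n) D.PerfectMatching ℤ}

/-- If a minor of `K` does not vanish, every perfect matching contains one of its edges. -/
lemma exists_mem_of_det_ne_zero (hKT : Kᵀ * T = D.matchingMatrix)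
    (hT : Submodule.span ℤ (Set.range T.col) = ⊤) {e : Fin n → E}
    (he : (K.submatrix id e).det ≠ 0) (a : D.PerfectMatching) : ∃ j, e j ∈ a.1 := by
  by_contra! h
  obtain ⟨u, hu, -⟩ := exists_vertex_degree hKT hT
  have h0 : T.col a = 0 := by
    refine Matrix.eq_zero_of_vecMul_eq_zero he ?_
    ext j
    have := col_dotProduct_col hKT (e j) a
    rw [if_neg (h j), dotProduct_comm] at this
    exact this
  have := hu a
  rw [h0, dotProduct_zero] at this
  exact zero_ne_one this

/-- For every perfect matching there is a non-vanishing minor of `K` that contains exactly one of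
its edges: a weighting with equal vertex sums that vanishes off the matching is constant on the
matching, so that the edges off the matching together with one of its edges span. -/
lemma exists_minor (hKT : Kᵀ * T = D.matchingMatrix)
    (hK : Submodule.span ℤ (Set.range K.col) = ⊤) (hT : Submodule.span ℤ (Set.range T.col) = ⊤)
    (a : D.PerfectMatching) :
    ∃ e : Fin n → E, (K.submatrix id e).det ≠ 0 ∧ ∑ j, (if e j ∈ a.1 then 1 else 0) = 1 := by
  obtain ⟨e₀, he₀, -⟩ := a.2.1 (D.whiteEnd D.nonempty.some)
  obtain ⟨u, -, hw, -⟩ := exists_vertex_degree hKT hT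
  let v : {e // e ∈ a.1 → e = e₀} → Fin n → ℚ := fun e i => K i e.1
  have hspan : Submodule.span ℚ (Set.range v) = ⊤ := by
    by_contra hne
    obtain ⟨f, hf0, hf⟩ := Submodule.exists_le_ker_of_lt_top _ (lt_top_iff_ne_top.2 hne)
    let F : (Fin n → ℤ) →+ ℚ := f.toAddMonoidHom.comp
      ((Int.castAddHom ℚ).compLeft (Fin n))
    have hF : ∀ e, (e ∈ a.1 → e = e₀) → F (K.col e) = 0 := by
      intro e he
      have : v ⟨e, he⟩ ∈ LinearMap.ker f := hf (Submodule.subset_span ⟨_, rfl⟩)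
      exact this
    -- the sum over a star is the value on the edge of the matching in it
    have hstar : ∀ e ∈ a.1, F (K.col e) = F u := by
      intro e he
      rw [← hw (D.whiteEnd e), map_sum]
      symm
      refine Finset.sum_eq_single e (fun e' he' hne' => hF e' fun h => ?_) (by simp)
      exact absurd ((a.2.1 (D.whiteEnd e)).unique ⟨h, (Finset.mem_filter.1 he').2⟩ ⟨he, rfl⟩) hne'
    have hu : F u = 0 := by
      rw [← hstar e₀ he₀.1]
      exact hF e₀ fun _ => rfl
    have hall : ∀ e, F (K.col e) = 0 := by
      intro e
      by_cases he : e ∈ a.1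
      · rw [hstar e he, hu]
      · exact hF e fun h => absurd h he
    have hF0 : ∀ x, F x = 0 := by
      intro x
      have hx : x ∈ Submodule.span ℤ (Set.range K.col) := hK ▸ Submodule.mem_top
      induction hx using Submodule.span_induction with
      | mem x hx =>
        obtain ⟨e, rfl⟩ := hx
        exact hall e
      | zero => exact map_zero F
      | add x y _ _ hx hy => rw [map_add, hx, hy, add_zero]
      | smul c x _ hx => rw [map_zsmul, hx, smul_zero]
    refine hf0 (LinearMap.pi_ext' fun i => LinearMap.ext_ring ?_)
    have h := hF0 (Pi.single i 1)
    have h1 : ((Int.castAddHom ℚ).compLeft (Fin n)) (Pi.single i 1) = Pi.single i 1 := by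
      ext k
      simp only [AddMonoidHom.compLeft_apply, Function.comp_apply, Int.coe_castAddHom,
        Pi.single_apply]
      split_ifs <;> simp
    rw [LinearMap.comp_apply, LinearMap.single_apply, LinearMap.zero_comp, LinearMap.zero_apply,
      ← h1]
    exact h
  obtain ⟨κ, b, hb, hbspan, hli⟩ := exists_linearIndependent' ℚ v
  rw [hspan] at hbspan
  let B := Module.Basis.mk hli hbspan.ge
  have : Fintype κ := FiniteDimensional.fintypeBasisIndex B
  have hcard : Fintype.card κ = n := by
    rw [← Module.finrank_eq_card_basis B, Module.finrank_pi, Fintype.card_fin]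
  let σ : Fin n ≃ κ := (Fintype.equivFinOfCardEq hcard).symm
  let e : Fin n → E := fun j => (b (σ j)).1
  have hdet : (K.submatrix id e).det ≠ 0 := by
    have h1 : LinearIndependent ℚ ((K.submatrix id e).map (Int.cast : ℤ → ℚ)).col :=
      hli.comp σ σ.injective
    rw [Matrix.linearIndependent_cols_iff_isUnit, Matrix.isUnit_iff_isUnit_det] at h1
    intro h0
    have h2 := (Int.castRingHom ℚ).map_det (K.submatrix id e)
    rw [h0, map_zero] at h2
    refine h1.ne_zero ?_
    rw [h2]
    rfl
  refine ⟨e, hdet, ?_⟩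
  obtain ⟨j, hj⟩ := exists_mem_of_det_ne_zero hKT hT hdet a
  rw [Finset.sum_eq_single j, if_pos hj]
  · intro k _ hk
    rw [if_neg]
    intro hk'
    refine hk (σ.injective (hb (Subtype.ext ?_)))
    exact ((b (σ k)).2 hk').trans ((b (σ j)).2 hj).symm
  · simp

end Minors

section Dimension

/-- Monomials with independent exponents are algebraically independent. -/
lemma algebraicIndependent_monomial {ι κ : Type*} [Fintype κ] (v : κ → ι →₀ ℕ)
    (hv : ∀ m m' : κ →₀ ℕ, ∑ j, m j • v j = ∑ j, m' j • v j → m = m') :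
    AlgebraicIndependent ℂ fun j => (monomial (v j) 1 : MvPolynomial ι ℂ) := by
  have hcoeff : ∀ (f : MvPolynomial κ ℂ) (m : κ →₀ ℕ),
      coeff (∑ j, m j • v j) (aeval (fun j => (monomial (v j) 1 : MvPolynomial ι ℂ)) f) =
        coeff m f := by
    intro f m
    induction f using MvPolynomial.induction_on' with
    | monomial m' c =>
      rw [aeval_monomial, Finsupp.prod_fintype _ _ (by simp)]
      simp only [monomial_pow, one_pow]
      rw [← monomial_sum_one, algebraMap_eq, C_mul_monomial, mul_one, coeff_monomial,
        coeff_monomial]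
      by_cases h : m' = m
      · rw [if_pos h, h, if_pos rfl]
      · rw [if_neg h, if_neg fun h' => h (hv _ _ h')]
    | add f g hf hg => rw [map_add, coeff_add, hf, hg, coeff_add]
  rw [algebraicIndependent_iff]
  intro f hf
  ext m
  rw [← hcoeff, hf, coeff_zero, coeff_zero]

/-- The dimension of the coherent component is the rank `g + 2` of the lattice: a non-vanishing
minor of `K` gives algebraically independent fields, and any algebraically independent fields have
linearly independent degrees. -/
theorem ringKrullDim_quotient_ker (hD : D.IsNondegenerate) :
    ringKrullDim (MvPolynomial E ℂ ⧸ RingHom.ker D.matchingMap) =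
      (D.numGaugeGroups + 2 : ℕ) := by
  obtain ⟨K, T, hKT, hK, hT⟩ := D.exists_toric_matrices hD
  apply le_antisymm
  · obtain ⟨S, hS, hS'⟩ := exists_algebraicIndependent_card_eq_ringKrullDim
      (adjoin_mk_X (RingHom.ker D.matchingMap))
    let F := FractionRing (MvPolynomial E ℂ ⧸ RingHom.ker D.matchingMap)
    let ι := algebraMap (MvPolynomial E ℂ ⧸ RingHom.ker D.matchingMap) F
    have hι : Function.Injective ι := IsFractionRing.injective _ _
    have hne : ∀ e, ι (Ideal.Quotient.mk _ (X e)) ≠ 0 := by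
      intro e h
      rw [map_eq_zero_iff _ hι, Ideal.Quotient.eq_zero_iff_mem] at h
      exact D.matchingMap_X_ne_zero e h
    obtain ⟨y, hw, hb⟩ := (D.fTerms_mk D.fTermIdeal_le_ker_matchingMap).exists_vertex_eq
    have hli : LinearIndependent ℤ fun s : S => K.col s := by
      rw [Fintype.linearIndependent_iff]
      intro c hc
      let c' : E → ℤ := fun e => if h : e ∈ S then c ⟨e, h⟩ else 0
      have hc' : ∀ s : S, c' s = c s := fun s => dif_pos s.2
      have h1 : ∑ e, c' e • K.col e = 0 := by
        rw [← Finset.sum_subset (Finset.subset_univ S) fun e _ he => by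
          simp only [c', dif_neg he, zero_smul], ← Finset.sum_coe_sort, ← hc]
        exact Finset.sum_congr rfl fun s _ => by rw [hc']
      rw [sum_smul_col_eq_zero_iff hKT hT] at h1
      have h2 := D.prod_zpow_eq_one hD (y := ι y) hne
        (fun v => by rw [← map_prod, ← hw v]) (fun v => by rw [← map_prod, ← hb v]) h1
      rw [← Finset.prod_subset (Finset.subset_univ S) fun e _ he => by
          simp only [c', dif_neg he, zpow_zero], ← Finset.prod_coe_sort] at h2
      intro s
      rw [← hc']
      exact congrFun (hS.eq_zero_of_prod_zpow_eq_one h2) s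
    have := hli.fintype_card_le_finrank
    rw [Module.finrank_pi, Fintype.card_fin, Fintype.card_coe] at this
    rw [hS']
    exact_mod_cast this
  · obtain ⟨a⟩ := hD.nonempty_matching
    obtain ⟨e, he, -⟩ := exists_minor hKT hK hT a
    have hai : AlgebraicIndependent ℂ fun j => D.matchingMap (X (e j)) := by
      simp only [matchingMap_X]
      refine algebraicIndependent_monomial _ fun m m' hm => ?_
      have h1 : ∀ m : Fin (D.numGaugeGroups + 2) →₀ ℕ, ∀ a : D.PerfectMatching,
          (K.submatrix id e *ᵥ fun j => (m j : ℤ)) ⬝ᵥ T.col a =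
          ((∑ j, m j • D.matchingDegree (Finsupp.single (e j) 1)) a : ℕ) := by
        intro m a
        have h2 : (K.submatrix id e *ᵥ fun j => (m j : ℤ)) = ∑ j, (m j : ℤ) • K.col (e j) := by
          ext i
          simp [Matrix.mulVec, dotProduct, Finset.sum_apply, mul_comm]
        rw [h2, sum_dotProduct, Finsupp.finsetSum_apply]
        rw [Nat.cast_sum]
        refine Finset.sum_congr rfl fun j _ => ?_
        rw [smul_dotProduct, col_dotProduct_col hKT, Finsupp.smul_apply, matchingDegree_single,
          smul_eq_mul, smul_eq_mul]
        push_cast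
        rfl
      have h3 : K.submatrix id e *ᵥ (fun j => (m j : ℤ) - m' j) = 0 := by
        refine eq_zero_of_dotProduct_col hT fun a => ?_
        have : (fun j => (m j : ℤ) - m' j) = (fun j => (m j : ℤ)) - fun j => (m' j : ℤ) := rfl
        rw [this, Matrix.mulVec_sub, sub_dotProduct, h1, h1, hm, sub_self]
      have h4 := Matrix.eq_zero_of_mulVec_eq_zero he h3
      ext j
      have := congrFun h4 j
      simp only [Pi.zero_apply] at this
      omega
    have hai' : AlgebraicIndependent ℂ fun j =>
        Ideal.Quotient.mk (RingHom.ker D.matchingMap) (X (e j)) :=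
      AlgebraicIndependent.of_comp (Ideal.kerLiftAlg D.matchingMap) hai
    have := card_le_ringKrullDim_of_algebraicIndependent hai'
    rw [Fintype.card_fin] at this
    exact_mod_cast this

end Dimension

end TorusDimer

/-! ### Normality and the canonical module -/

section ModuleLemmas

variable {R M : Type*} [CommRing R] [AddCommGroup M] [Module R M]

/-- An alternating form scales by the determinant under a linear substitution. -/
lemma AlternatingMap.map_sum_smul_eq_det {n : ℕ} (φ : M [⋀^Fin n]→ₗ[R] R) (b : Fin n → M)
    (A : Matrix (Fin n) (Fin n) R) : φ (fun j => ∑ i, A i j • b i) = A.det * φ b := by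
  let L : (Fin n → R) →ₗ[R] M := Fintype.linearCombination R b
  have h := DFunLike.congr_fun
    (AlternatingMap.eq_smul_basis_det (Pi.basisFun R (Fin n)) (φ.compLinearMap L)) fun j i => A i j
  rw [AlternatingMap.smul_apply, Pi.basisFun_det_apply, AlternatingMap.compLinearMap_apply,
    AlternatingMap.compLinearMap_apply] at h
  have h1 : (fun j => L fun i => A i j) = fun j => ∑ i, A i j • b i := rfl
  have h2 : (fun j => L (Pi.basisFun R (Fin n) j)) = b := by
    ext j
    simp [L, Fintype.linearCombination_apply, Pi.single_apply]
  rw [h1, h2, smul_eq_mul, mul_comm] at h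
  rw [h]
  congr 1
  exact Matrix.det_transpose A

variable [IsDomain R]

lemma exists_smul_eq_of_forall_dvd {y : R} (hy : y ≠ 0) (f : M →ₗ[R] R) (h : ∀ m, y ∣ f m) :
    ∃ g : M →ₗ[R] R, f = y • g := by
  choose g hg using h
  refine ⟨⟨⟨g, fun a b => mul_left_cancel₀ hy ?_⟩, fun c a => mul_left_cancel₀ hy ?_⟩, ?_⟩
  · rw [← hg, map_add, hg, hg, mul_add]
  · rw [← hg, map_smul, hg, smul_eq_mul, RingHom.id_apply, smul_eq_mul, mul_left_comm]
  · ext m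
    exact hg m

/-- If every functional on `M` is a multiple of a fixed non-zero one, the bidual is free of
rank one. -/
lemma nonempty_bidual_equiv {g : M →ₗ[R] R} (hg : g ≠ 0) (h : ∀ f : M →ₗ[R] R, ∃ r : R, f = r • g) :
    Nonempty (Module.Dual R (Module.Dual R M) ≃ₗ[R] R) := by
  let L : R →ₗ[R] Module.Dual R M := LinearMap.toSpanSingleton R _ g
  have hL : Function.Bijective L := by
    constructor
    · rw [← LinearMap.ker_eq_bot, LinearMap.ker_eq_bot']
      intro r hr
      obtain ⟨m, hm⟩ : ∃ m, g m ≠ 0 := by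
        by_contra! hcon
        exact hg (LinearMap.ext hcon)
      have : r * g m = 0 := LinearMap.congr_fun hr m
      exact (mul_eq_zero.1 this).resolve_right hm
    · intro f
      obtain ⟨r, rfl⟩ := h f
      exact ⟨r, rfl⟩
  exact ⟨(LinearEquiv.ofBijective L hL).dualMap.trans (LinearMap.ringLmapEquivSelf R R R)⟩

lemma Derivation.map_prod {k A N E : Type*} [CommRing k] [CommRing A] [Algebra k A]
    [AddCommGroup N] [Module k N] [Module A N] (d : Derivation k A N) (s : Finset E) (x : E → A) :
    d (∏ e ∈ s, x e) = ∑ e ∈ s, (∏ f ∈ s.erase e, x f) • d (x e) := by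
  induction s using Finset.induction_on with
  | empty => simp
  | insert a s ha ih =>
    rw [Finset.prod_insert ha, Derivation.leibniz, ih, Finset.sum_insert ha,
      Finset.erase_insert ha, add_comm, Finset.smul_sum]
    congr 1
    refine Finset.sum_congr rfl fun e he => ?_
    have hae : a ≠ e := fun h => ha (h ▸ he)
    rw [Finset.erase_insert_of_ne hae, Finset.prod_insert fun h => ha (Finset.mem_of_mem_erase h),
      mul_smul]

/-- A criterion for the top exterior power of `M` to have a bidual that is free of rank one. Here
`ω` are generators of `M`, in practice the differentials of elements `x e`, which are combinations
with coefficients `k` of `b`, in practice logarithmic differentials, up to multiplication by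
functions. The map `L` gives a volume form with values `(∏ x) * det k`; it is divisible by `y`, and
its quotient by `y` generates the dual. -/
theorem nonempty_bidual_exteriorPower_equiv {E : Type*} [Fintype E] {n : ℕ} {ω : E → M}
    (hω : Submodule.span R (Set.range ω) = ⊤) {x : E → R} (hx : ∀ e, x e ≠ 0) {k : Fin n → E → R}
    {b : Fin n → M} (hb : ∀ e, (∏ f, x f) • ω e = x e • ∑ i, k i e • b i)
    (L : M →ₗ[R] Fin n → R) (hL : ∀ e i, L (ω e) i = x e * k i e) {y : R} (hy : y ≠ 0)
    (hdvd : ∀ e : Fin n → E, y ∣ (∏ j, x (e j)) * Matrix.det fun i j => k i (e j))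
    (hne : ∃ e : Fin n → E, Matrix.det (fun i j => k i (e j)) ≠ 0)
    (hgen : ∀ s : R, (∀ e : Fin n → E, (∏ f, x f) ^ n ∣
      s * ((∏ j, x (e j)) * Matrix.det fun i j => k i (e j))) → (∏ f, x f) ^ n ∣ s * y) :
    Nonempty (Module.Dual R (Module.Dual R (⋀[R]^n M)) ≃ₗ[R] R) := by
  have hspan := exteriorPower.ιMulti_span_of_span R n M hω
  have hc0 : (∏ f, x f) ^ n ≠ 0 := pow_ne_zero _ (Finset.prod_ne_zero_iff.2 fun e _ => hx e)
  let Ψ := exteriorPower.alternatingMapLinearEquiv (Matrix.detRowAlternating.compLinearMap L)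
  have hΨ : ∀ e : Fin n → E, Ψ (exteriorPower.ιMulti R n fun j => ω (e j)) =
      (∏ j, x (e j)) * Matrix.det fun i j => k i (e j) := by
    intro e
    refine (exteriorPower.alternatingMapLinearEquiv_apply_ιMulti _ _).trans ?_
    rw [AlternatingMap.compLinearMap_apply]
    change Matrix.det _ = _
    have h : (fun j => L (ω (e j))) =
        Matrix.of fun j i => x (e j) * (Matrix.transpose fun i j => k i (e j)) j i := by
      ext j i
      exact hL _ _
    rw [h, Matrix.det_mul_column]
    exact congrArg _ (Matrix.det_transpose _)
  have hgenerators : ∀ η ∈ exteriorPower.ιMulti R n '' {a | Set.range a ⊆ Set.range ω},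
      ∃ e : Fin n → E, η = exteriorPower.ιMulti R n fun j => ω (e j) := by
    rintro _ ⟨a, ha, rfl⟩
    choose e he using fun j => ha ⟨j, rfl⟩
    exact ⟨e, congrArg _ (funext fun j => (he j).symm)⟩
  obtain ⟨g, hg⟩ := exists_smul_eq_of_forall_dvd hy Ψ (by
    have : LinearMap.range Ψ ≤ Ideal.span {y} := by
      rw [LinearMap.range_eq_map, ← hspan, Submodule.map_span, Submodule.span_le]
      rintro _ ⟨η, hη, rfl⟩
      obtain ⟨e, rfl⟩ := hgenerators η hη
      rw [SetLike.mem_coe, hΨ]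
      exact Ideal.mem_span_singleton.2 (hdvd e)
    exact fun m => Ideal.mem_span_singleton.1 (this ⟨m, rfl⟩))
  refine nonempty_bidual_equiv (g := g) ?_ ?_
  · rintro rfl
    obtain ⟨e, he⟩ := hne
    have h := hΨ e
    rw [hg, smul_zero, LinearMap.zero_apply] at h
    exact mul_ne_zero (Finset.prod_ne_zero_iff.2 fun j _ => hx (e j)) he h.symm
  · intro φ
    let φ' := exteriorPower.alternatingMapLinearEquiv.symm φ
    have hφ : ∀ e : Fin n → E,
        (∏ f, x f) ^ n * φ (exteriorPower.ιMulti R n fun j => ω (e j)) =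
        φ' b * ((∏ j, x (e j)) * Matrix.det fun i j => k i (e j)) := by
      intro e
      have h2 := φ'.map_smul_univ (fun _ => ∏ f, x f) fun j => ω (e j)
      rw [Finset.prod_const, Finset.card_univ, Fintype.card_fin, smul_eq_mul] at h2
      simp only [hb] at h2
      rw [φ'.map_smul_univ, smul_eq_mul, φ'.map_sum_smul_eq_det b fun i j => k i (e j)] at h2
      have h1 : φ (exteriorPower.ιMulti R n fun j => ω (e j)) = φ' fun j => ω (e j) :=
        (exteriorPower.alternatingMapLinearEquiv_symm_apply φ _).symm
      rw [h1, ← h2]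
      ring
    have hφg : (∏ f, x f) ^ n • φ = (φ' b * y) • g := by
      refine LinearMap.ext_on hspan fun η hη => ?_
      obtain ⟨e, rfl⟩ := hgenerators η hη
      rw [LinearMap.smul_apply, smul_eq_mul, hφ, ← hΨ, hg, mul_smul]
      rfl
    obtain ⟨r, hr⟩ := hgen (φ' b) fun e => ⟨_, (hφ e).symm⟩
    refine ⟨r, ?_⟩
    rw [hr, mul_smul] at hφg
    refine LinearMap.ext fun m => mul_left_cancel₀ hc0 ?_
    exact LinearMap.congr_fun hφg m

end ModuleLemmas

namespace TorusDimer

open MvPolynomial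

variable {E : Type*} [Fintype E]

/-- The coordinate ring of the coherent component. -/
abbrev CoherentRing (D : TorusDimer E) : Type _ := MvPolynomial E ℂ ⧸ RingHom.ker D.matchingMap

variable {D : TorusDimer E}

variable (D) in
/-- The field `X_e` as a function on the coherent component. -/
def field (e : E) : D.CoherentRing := Ideal.Quotient.mk _ (X e)

variable (D) in
/-- The embedding of the coordinate ring of the coherent component into `ℂ[p_1, …, p_c]`. -/
def embedding : D.CoherentRing →ₐ[ℂ] MvPolynomial D.PerfectMatching ℂ :=
  Ideal.kerLiftAlg D.matchingMap

lemma embedding_injective : Function.Injective D.embedding :=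
  Ideal.kerLiftAlg_injective D.matchingMap

lemma embedding_field (e : E) : D.embedding (D.field e) =
    monomial (D.matchingDegree (Finsupp.single e 1)) 1 := D.matchingMap_X e

lemma field_ne_zero (e : E) : D.field e ≠ 0 := fun h =>
  D.matchingMap_X_ne_zero e (Ideal.Quotient.eq_zero_iff_mem.1 h)

lemma embedding_prod_field {ι : Type*} (s : Finset ι) (e : ι → E) :
    D.embedding (∏ j ∈ s, D.field (e j)) =
      monomial (∑ j ∈ s, D.matchingDegree (Finsupp.single (e j) 1)) 1 := by
  rw [_root_.map_prod, Finset.prod_congr rfl fun j _ => embedding_field (e j), ← monomial_sum_one]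

lemma exists_embedding_eq (hD : D.IsNondegenerate) {f : MvPolynomial D.PerfectMatching ℂ}
    {c a : D.CoherentRing} (hc : c ≠ 0) (h : f * D.embedding c = D.embedding a) :
    ∃ r, D.embedding r = f := by
  have hrange : ∀ a, D.embedding a ∈ D.matchingMap.range := by
    intro a
    obtain ⟨a, rfl⟩ := Ideal.Quotient.mk_surjective a
    exact ⟨a, rfl⟩
  obtain ⟨g, hg⟩ := mem_range_matchingMap_of_mul_mem hD (hrange c)
    (fun h0 => hc (embedding_injective (h0.trans (map_zero _).symm))) (h ▸ hrange a)
  exact ⟨Ideal.Quotient.mk _ g, hg⟩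

/-- The coherent component is normal: its coordinate ring is saturated in a polynomial ring. -/
theorem isIntegrallyClosed_coherentRing (hD : D.IsNondegenerate) :
    IsIntegrallyClosed D.CoherentRing := by
  let S := MvPolynomial D.PerfectMatching ℂ
  let F := FractionRing D.CoherentRing
  let ι : D.CoherentRing →+* S := D.embedding.toRingHom
  have hι : Function.Injective ι := embedding_injective
  let j : F →+* FractionRing S := IsFractionRing.map (A := D.CoherentRing) hι
  have hj : ∀ a : D.CoherentRing, j (algebraMap _ F a) = algebraMap S (FractionRing S) (ι a) :=
    fun a => IsLocalization.map_eq _ a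
  rw [isIntegrallyClosed_iff F]
  rintro z hz
  have hjz : IsIntegral S (j z) := by
    obtain ⟨p, hp, hpz⟩ := hz
    refine ⟨p.map ι, hp.map ι, ?_⟩
    rw [Polynomial.eval₂_map]
    have : (algebraMap S (FractionRing S)).comp ι = j.comp (algebraMap _ F) :=
      RingHom.ext fun a => (hj a).symm
    rw [this, ← Polynomial.hom_eval₂, hpz, map_zero]
  obtain ⟨f, hf⟩ := IsIntegrallyClosed.isIntegral_iff.1 hjz
  obtain ⟨a, c, hc, rfl⟩ := IsFractionRing.div_surjective (A := D.CoherentRing) z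
  have hc0 : c ≠ 0 := nonZeroDivisors.ne_zero hc
  have hc1 : algebraMap _ F c ≠ 0 :=
    (map_ne_zero_iff _ (IsFractionRing.injective D.CoherentRing F)).2 hc0
  have hfac : f * ι c = ι a := by
    apply IsFractionRing.injective S (FractionRing S)
    rw [map_mul, hf, ← hj, ← hj, ← map_mul, div_mul_cancel₀ _ hc1]
  obtain ⟨r, hr⟩ := exists_embedding_eq hD hc0 hfac
  refine ⟨r, ?_⟩
  rw [eq_div_iff hc1, ← map_mul]
  congr 1
  apply hι
  rw [map_mul, ← hfac]
  congr 1

section Differentials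

variable {n : ℕ} {K : Matrix (Fin n) E ℤ} {T : Matrix (Fin n) D.PerfectMatching ℤ}

/-- The invariant vector field of weight `θ`, which multiplies `X_e` by `θ e`. -/
def weightDerivation (θ : E → ℤ) : Derivation ℂ (MvPolynomial E ℂ) (MvPolynomial E ℂ) :=
  mkDerivation ℂ fun e => C (θ e : ℂ) * X e

lemma weightDerivation_monomial (θ : E → ℤ) (m : E →₀ ℕ) :
    weightDerivation θ (monomial m 1) = monomial m ((∑ e, (m e : ℤ) * θ e : ℤ) : ℂ) := by
  unfold weightDerivation
  rw [mkDerivation_monomial, one_smul, Finsupp.sum_fintype _ _ (by simp), Int.cast_sum, map_sum]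
  refine Finset.sum_congr rfl fun e _ => ?_
  rw [smul_eq_mul]
  by_cases h : m e = 0
  · simp [h]
  · have hle : Finsupp.single e 1 ≤ m := by
      rw [Finsupp.single_le_iff]
      exact Nat.one_le_iff_ne_zero.2 h
    rw [mul_left_comm, X, monomial_mul, tsub_add_cancel_of_le hle, C_mul_monomial, mul_one]
    push_cast
    rw [mul_comm]

/-- The rows of `K` are weights of vector fields on the coherent component. -/
lemma exists_derivation (hKT : Kᵀ * T = D.matchingMatrix)
    (hT : Submodule.span ℤ (Set.range T.col) = ⊤) (i : Fin n) :
    ∃ δ : Derivation ℂ D.CoherentRing D.CoherentRing,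
      ∀ e, δ (D.field e) = (K i e : D.CoherentRing) * D.field e := by
  have hker : ∀ f, Ideal.Quotient.mkₐ ℂ (RingHom.ker D.matchingMap) f = 0 →
      Ideal.Quotient.mkₐ ℂ (RingHom.ker D.matchingMap) (weightDerivation (K i) f) = 0 := by
    intro f hf
    refine Ideal.Quotient.eq_zero_iff_mem.2 ?_
    replace hf : D.matchingMap f = 0 := Ideal.Quotient.eq_zero_iff_mem.1 hf
    refine D.eq_zero_of_matchingMap_eq_zero
      (D.matchingMap.toLinearMap ∘ₗ (weightDerivation (K i)).toLinearMap) (fun m m' hm => ?_) hf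
    have hdeg : ∑ e, ((m e : ℤ) - m' e) • K.col e = 0 := by
      rw [sum_smul_col_eq_zero_iff hKT hT]
      intro a
      have := DFunLike.congr_fun hm a
      rw [matchingDegree_apply, matchingDegree_apply] at this
      rw [Finset.sum_sub_distrib, sub_eq_zero]
      exact_mod_cast this
    have hi := congrFun hdeg i
    simp only [Finset.sum_apply, Pi.smul_apply, Matrix.col_apply, smul_eq_mul, Pi.zero_apply,
      sub_mul, Finset.sum_sub_distrib, sub_eq_zero] at hi
    change D.matchingMap (weightDerivation (K i) _) = D.matchingMap (weightDerivation (K i) _)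
    rw [weightDerivation_monomial, weightDerivation_monomial, matchingMap_monomial,
      matchingMap_monomial, hm, hi]
  refine ⟨Derivation.liftOfSurjective
    (Ideal.Quotient.mkₐ_surjective ℂ (RingHom.ker D.matchingMap)) hker, fun e => ?_⟩
  have h := Derivation.liftOfSurjective_apply
    (Ideal.Quotient.mkₐ_surjective ℂ (RingHom.ker D.matchingMap)) hker (X e)
  refine Eq.trans h ?_
  unfold weightDerivation
  rw [mkDerivation_X, map_mul]
  congr 1

section LogDifferential

variable {M : Type*} [AddCommGroup M] [Module D.CoherentRing M] [Module ℂ M]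
  (d : Derivation ℂ D.CoherentRing M)

/-- The logarithmic differential of `X_e`, multiplied by the product of all fields. -/
def logDifferential (e : E) : M := (∏ f ∈ Finset.univ.erase e, D.field f) • d (D.field e)

lemma prod_smul_D_field (e : E) :
    (∏ f, D.field f) • d (D.field e) = D.field e • logDifferential d e := by
  rw [logDifferential, smul_smul, Finset.mul_prod_erase _ _ (Finset.mem_univ e)]

lemma sum_logDifferential (s : Finset E) : ∑ e ∈ s, logDifferential d e =
    (∏ f ∈ sᶜ, D.field f) • d (∏ e ∈ s, D.field e) := by
  rw [Derivation.map_prod, Finset.smul_sum]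
  refine Finset.sum_congr rfl fun e he => ?_
  rw [logDifferential, smul_smul]
  congr 1
  rw [← Finset.prod_union]
  · refine Finset.prod_congr ?_ fun _ _ => rfl
    ext f
    simp only [Finset.mem_erase, Finset.mem_univ, Finset.mem_union, Finset.mem_compl]
    constructor
    · intro h
      by_cases hf : f ∈ s
      · exact Or.inr ⟨h.1, hf⟩
      · exact Or.inl hf
    · rintro (h | h)
      · exact ⟨fun h' => h (h' ▸ he), trivial⟩
      · exact ⟨h.1, trivial⟩
  · rw [Finset.disjoint_left]
    intro f hf hf'
    exact Finset.mem_compl.1 hf (Finset.mem_of_mem_erase hf')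

lemma exists_vertex_field : ∃ y : D.CoherentRing, y ≠ 0 ∧
    (∀ v, ∏ e with D.whiteEnd e = v, D.field e = y) ∧
    (∀ v, ∏ e with D.blackEnd e = v, D.field e = y) := by
  obtain ⟨y, hw, hb⟩ := (D.fTerms_mk D.fTermIdeal_le_ker_matchingMap).exists_vertex_eq
  refine ⟨y, ?_, hw, hb⟩
  obtain ⟨v⟩ := (inferInstance : Nonempty D.White)
  rw [← hw v]
  exact Finset.prod_ne_zero_iff.2 fun e _ => field_ne_zero e

/-- The logarithmic differentials satisfy the linear relations among the columns of `K`. -/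
lemma exists_logDifferential_basis (hD : D.IsNondegenerate) (hKT : Kᵀ * T = D.matchingMatrix)
    (hK : Submodule.span ℤ (Set.range K.col) = ⊤) (hT : Submodule.span ℤ (Set.range T.col) = ⊤) :
    ∃ b : Fin n → M, ∀ e, logDifferential d e = ∑ i, (K i e : D.CoherentRing) • b i := by
  obtain ⟨y, hy, hw, hb⟩ := exists_vertex_field (D := D)
  have hcompl : ∀ s t : Finset E, ∏ e ∈ s, D.field e = y → ∏ e ∈ t, D.field e = y →
      ∑ e ∈ s, logDifferential d e = ∑ e ∈ t, logDifferential d e := by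
    intro s t hs ht
    rw [sum_logDifferential, sum_logDifferential, hs, ht]
    congr 1
    refine mul_left_cancel₀ hy ?_
    nth_rw 1 [← hs]
    rw [← ht, Finset.prod_mul_prod_compl, Finset.prod_mul_prod_compl]
  obtain ⟨v₀⟩ := (inferInstance : Nonempty D.White)
  choose x hx using fun i => (Submodule.mem_span_range_iff_exists_fun ℤ).1
    (hK ▸ Submodule.mem_top : (Pi.single i 1 : Fin n → ℤ) ∈ Submodule.span ℤ (Set.range K.col))
  refine ⟨fun i => ∑ e, x i e • logDifferential d e, fun e => ?_⟩
  have h1 : ∑ f, ((if f = e then 1 else 0) - ∑ i, K i e * x i f) • K.col f = 0 := by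
    simp only [sub_smul, Finset.sum_sub_distrib, Finset.sum_smul, mul_smul]
    rw [Finset.sum_comm]
    simp only [← Finset.smul_sum, hx]
    ext i
    simp [Finset.sum_apply, Pi.single_apply]
  rw [sum_smul_col_eq_zero_iff hKT hT] at h1
  have h2 := D.sum_smul_eq_zero hD (g := logDifferential d)
    (y := ∑ e with D.whiteEnd e = v₀, logDifferential d e)
    (fun v => hcompl _ _ (hw v) (hw v₀)) (fun v => hcompl _ _ (hb v) (hw v₀)) h1
  simp only [sub_smul, Finset.sum_sub_distrib, Finset.sum_smul, mul_smul] at h2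
  rw [Finset.sum_comm, sub_eq_zero] at h2
  simp only [← Finset.smul_sum] at h2
  simp only [ite_smul, one_smul, zero_smul, Finset.sum_ite_eq', Finset.mem_univ, if_true] at h2
  rw [h2]
  exact Finset.sum_congr rfl fun i _ => (Int.cast_smul_eq_zsmul _ _ _).symm

end LogDifferential

lemma span_D_field : Submodule.span D.CoherentRing
    (Set.range fun e => KaehlerDifferential.D ℂ D.CoherentRing (D.field e)) = ⊤ := by
  rw [eq_top_iff, ← KaehlerDifferential.span_range_derivation, Submodule.span_le]
  rintro _ ⟨f, rfl⟩
  obtain ⟨f, rfl⟩ := Ideal.Quotient.mk_surjective f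
  induction f using MvPolynomial.induction_on with
  | C c =>
    have : Ideal.Quotient.mk (RingHom.ker D.matchingMap) (C c) =
      algebraMap ℂ D.CoherentRing c := rfl
    rw [this, Derivation.map_algebraMap]
    exact zero_mem _
  | add f g hf hg =>
    rw [map_add, map_add]
    exact add_mem hf hg
  | mul_X f e hf =>
    rw [map_mul, Derivation.leibniz]
    exact add_mem (Submodule.smul_mem _ _ (Submodule.subset_span ⟨e, rfl⟩))
      (Submodule.smul_mem _ _ hf)

/-- The minors of `K` over the coordinate ring are the images of its integral minors. -/
lemma det_cast (e : Fin n → E) : Matrix.det (fun i j => (K i (e j) : D.CoherentRing)) =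
    ((K.submatrix id e).det : D.CoherentRing) :=
  ((Int.castRingHom D.CoherentRing).map_det (K.submatrix id e)).symm

lemma embedding_intCast (z : ℤ) : D.embedding (z : D.CoherentRing) = C (z : ℂ) := by
  rw [map_intCast]
  exact (map_intCast (C : ℂ →+* MvPolynomial D.PerfectMatching ℂ) z).symm

lemma embedding_vertex {y : D.CoherentRing} {v : D.White}
    (hy : ∏ e with D.whiteEnd e = v, D.field e = y) :
    D.embedding y = monomial (Finsupp.equivFunOnFinite.symm fun _ => 1) 1 := by
  rw [← hy, embedding_prod_field]
  refine congrArg (fun d => monomial d (1 : ℂ)) (Finsupp.ext fun a => ?_)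
  rw [Finsupp.finsetSum_apply, Finset.sum_congr rfl fun e _ => D.matchingDegree_single e a,
    sum_star_white]
  rfl

lemma sum_matchingDegree_single_apply {ι : Type*} (s : Finset ι) (e : ι → E)
    (a : D.PerfectMatching) : (∑ j ∈ s, D.matchingDegree (Finsupp.single (e j) 1)) a =
      ∑ j ∈ s, if e j ∈ a.1 then 1 else 0 := by
  rw [Finsupp.finsetSum_apply]
  exact Finset.sum_congr rfl fun j _ => D.matchingDegree_single (e j) a

/-- The volume form is divisible by the vertex monomial, as a non-vanishing minor of `K` meets every
perfect matching. -/
lemma vertex_dvd_prod_mul_det (hD : D.IsNondegenerate) (hKT : Kᵀ * T = D.matchingMatrix)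
    (hT : Submodule.span ℤ (Set.range T.col) = ⊤) {y : D.CoherentRing} (hy : y ≠ 0)
    (hyemb : D.embedding y = monomial (Finsupp.equivFunOnFinite.symm fun _ => 1) 1)
    (e : Fin n → E) :
    y ∣ (∏ j, D.field (e j)) * Matrix.det fun i j => (K i (e j) : D.CoherentRing) := by
  rw [det_cast]
  by_cases hdet : (K.submatrix id e).det = 0
  · rw [hdet, Int.cast_zero, mul_zero]
    exact dvd_zero y
  · refine Dvd.dvd.mul_right ?_ _
    set d := ∑ j, D.matchingDegree (Finsupp.single (e j) 1) with hd
    have hle : Finsupp.equivFunOnFinite.symm (fun _ => 1) ≤ d := by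
      intro a
      obtain ⟨j, hj⟩ := exists_mem_of_det_ne_zero hKT hT hdet a
      rw [hd, sum_matchingDegree_single_apply]
      refine le_trans ?_ (Finset.single_le_sum (fun _ _ => Nat.zero_le _) (Finset.mem_univ j))
      rw [if_pos hj]
      exact le_rfl
    have hmul : monomial (d - Finsupp.equivFunOnFinite.symm fun _ => 1) 1 * D.embedding y =
        D.embedding (∏ j, D.field (e j)) := by
      rw [embedding_prod_field, hyemb, monomial_mul, tsub_add_cancel_of_le hle, one_mul]
    obtain ⟨r, hr⟩ := exists_embedding_eq hD hy hmul
    refine ⟨r, embedding_injective ?_⟩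
    rw [map_mul, hr, mul_comm, hmul]

/-- The volume form divided by the vertex monomial vanishes along no divisor `p_a = 0`, as some
non-vanishing minor of `K` meets the perfect matching `a` just once. -/
lemma prod_pow_dvd_mul_vertex (hD : D.IsNondegenerate) (hKT : Kᵀ * T = D.matchingMatrix)
    (hK : Submodule.span ℤ (Set.range K.col) = ⊤) (hT : Submodule.span ℤ (Set.range T.col) = ⊤)
    {y : D.CoherentRing}
    (hyemb : D.embedding y = monomial (Finsupp.equivFunOnFinite.symm fun _ => 1) 1)
    {s : D.CoherentRing} (hs : ∀ e : Fin n → E, (∏ f, D.field f) ^ n ∣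
      s * ((∏ j, D.field (e j)) * Matrix.det fun i j => (K i (e j) : D.CoherentRing))) :
    (∏ f, D.field f) ^ n ∣ s * y := by
  set c : D.CoherentRing := (∏ f, D.field f) ^ n with hc
  have hc0 : c ≠ 0 := pow_ne_zero _ (Finset.prod_ne_zero_iff.2 fun e _ => field_ne_zero e)
  set C₀ := n • ∑ e, D.matchingDegree (Finsupp.single e 1)
  have hcemb : D.embedding c = monomial C₀ 1 := by
    rw [hc, map_pow, embedding_prod_field, monomial_pow, one_pow]
  obtain ⟨f, hf⟩ : D.embedding c ∣ D.embedding (s * y) := by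
    rw [hcemb, monomial_one_dvd_iff_modMonomial_eq_zero]
    ext d
    rw [coeff_zero]
    by_contra hne
    have hd : ¬ C₀ ≤ d := fun h => hne (coeff_modMonomial_of_le _ h)
    rw [coeff_modMonomial_of_not_le _ hd] at hne
    refine hd fun a => ?_
    obtain ⟨e, he, ha⟩ := exists_minor hKT hK hT a
    obtain ⟨q, hq⟩ := hs e
    set w := ∑ j, D.matchingDegree (Finsupp.single (e j) 1) with hw
    have hwa : w a = 1 := by rw [hw, sum_matchingDegree_single_apply, ha]
    -- compare the coefficients at `d + w`, where `w` has exponent one at `a`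
    have h1 : D.embedding (s * y) * monomial w ((K.submatrix id e).det : ℂ) =
        monomial (C₀ + Finsupp.equivFunOnFinite.symm fun _ => 1) 1 * D.embedding q := by
      have h2 := congrArg (fun z => D.embedding (z * y)) hq
      simp only [det_cast, map_mul, embedding_prod_field, hcemb, embedding_intCast] at h2
      have h3 : monomial w ((K.submatrix id e).det : ℂ) =
          monomial w 1 * C ((K.submatrix id e).det : ℂ) := by
        rw [mul_comm, C_mul_monomial, mul_one]
      have h4 : (monomial (C₀ + Finsupp.equivFunOnFinite.symm fun _ => 1) 1 :
          MvPolynomial D.PerfectMatching ℂ) = monomial C₀ 1 * D.embedding y := by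
        rw [hyemb, monomial_mul, one_mul]
      rw [h3, h4, map_mul]
      linear_combination h2
    have h5 := congrArg (coeff (d + w)) h1
    rw [coeff_mul_monomial] at h5
    have h6 : coeff (d + w) (monomial (C₀ + Finsupp.equivFunOnFinite.symm fun _ => 1) 1 *
        D.embedding q) ≠ 0 := by
      rw [← h5]
      exact mul_ne_zero hne (Int.cast_ne_zero.2 he)
    rw [coeff_monomial_mul'] at h6
    have h7 : C₀ + (Finsupp.equivFunOnFinite.symm fun _ => 1) ≤ d + w := by
      by_contra hcon
      exact h6 (if_neg hcon)
    have h8 := h7 a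
    rw [Finsupp.add_apply, Finsupp.add_apply, hwa] at h8
    exact Nat.le_of_add_le_add_right h8
  obtain ⟨r, hr⟩ := exists_embedding_eq hD hc0 ((mul_comm f _).trans hf.symm)
  exact ⟨r, embedding_injective (by rw [hf, map_mul, hr])⟩

/-- The canonical module is trivial: the invariant volume form divided by the vertex monomial
generates it. -/
theorem canonicalModule_trivial (hD : D.IsNondegenerate) (hKT : Kᵀ * T = D.matchingMatrix)
    (hK : Submodule.span ℤ (Set.range K.col) = ⊤) (hT : Submodule.span ℤ (Set.range T.col) = ⊤) :
    Nonempty (CanonicalModule D.CoherentRing n ≃ₗ[D.CoherentRing] D.CoherentRing) := by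
  obtain ⟨y, hy, hw, -⟩ := exists_vertex_field (D := D)
  obtain ⟨v₀⟩ := (inferInstance : Nonempty D.White)
  have hyemb := embedding_vertex (hw v₀)
  obtain ⟨b, hb⟩ :=
    exists_logDifferential_basis (KaehlerDifferential.D ℂ D.CoherentRing) hD hKT hK hT
  choose δ hδ using exists_derivation (K := K) hKT hT
  refine nonempty_bidual_exteriorPower_equiv (span_D_field (D := D)) field_ne_zero
    (k := fun i e => (K i e : D.CoherentRing)) (b := b) (fun e => ?_)
    (LinearMap.pi fun i => (δ i).liftKaehlerDifferential) (fun e i => ?_) hy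
    (vertex_dvd_prod_mul_det hD hKT hT hy hyemb) ?_
    fun s hs => prod_pow_dvd_mul_vertex hD hKT hK hT hyemb hs
  · rw [← hb]
    exact prod_smul_D_field _ e
  · rw [LinearMap.pi_apply, Derivation.liftKaehlerDifferential_comp_D, hδ, mul_comm]
  · obtain ⟨a⟩ := hD.nonempty_matching
    obtain ⟨e, he, -⟩ := exists_minor hKT hK hT a
    refine ⟨e, fun h => he ?_⟩
    rw [det_cast] at h
    have h1 := congrArg D.embedding h
    rw [embedding_intCast, map_zero, C_eq_zero] at h1
    exact_mod_cast h1

end Differentials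

end TorusDimer

end

theorem mainTheorem1 {E : Type*} [Fintype E] (D : TorusDimer E) (hD : D.IsNondegenerate) :
    (∀ m : D.PerfectMatching, 2 * m.1.card = D.numVertices) ∧
    (1 : E → ℚ) ᵥ* D.matchingMatrix.map (Int.cast : ℤ → ℚ) =
      ((D.numVertices : ℚ) / 2) • (1 : D.PerfectMatching → ℚ) ∧
    ∃ p : Ideal (MvPolynomial E ℂ),
      (∀ q : Ideal (MvPolynomial E ℂ), D.IsTopComponent q ↔ q = p) ∧
      IsAffineCalabiYau (MvPolynomial E ℂ ⧸ p) (D.numGaugeGroups + 2) ∧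
      (∀ (r : ℕ) (Q : Matrix D.PerfectMatching (Fin r) ℤ), IsKernelMatrix D.matchingMatrix Q →
        r + (D.numGaugeGroups + 2) = Fintype.card D.PerfectMatching ∧
        RingHom.ker D.matchingMap = p ∧
        D.matchingMap.range = quotientRing Q ∧
        (1 : D.PerfectMatching → ℤ) ᵥ* Q = 0) ∧
      ∃ (K : Matrix (Fin (D.numGaugeGroups + 2)) E ℤ)
        (T : Matrix (Fin (D.numGaugeGroups + 2)) D.PerfectMatching ℤ),
        Kᵀ * T = D.matchingMatrix ∧
        Submodule.span ℤ (Set.range K.col) = ⊤ ∧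
        Submodule.span ℤ (Set.range T.col) = ⊤ ∧
        AddSubmonoid.closure (Set.range K.col) = dualSemigroup T ∧
        (∃ φ : (MvPolynomial E ℂ ⧸ p) ≃ₐ[ℂ] AddMonoidAlgebra ℂ (dualSemigroup T),
          ∀ (e : E) (he : K.col e ∈ dualSemigroup T),
            φ (Ideal.Quotient.mk p (MvPolynomial.X e)) = AddMonoidAlgebra.single ⟨K.col e, he⟩ 1) ∧
        (∀ a : D.PerfectMatching, (fun i => (T i a : ℝ)) ∉ columnCone T {a}ᶜ) ∧
        ∃ u : Fin (D.numGaugeGroups + 2) → ℤ, ∀ a : D.PerfectMatching, u ⬝ᵥ T.col a = 1 := by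
  obtain ⟨K, T, hKT, hK, hT⟩ := D.exists_toric_matrices hD
  have hcard : ∀ m : D.PerfectMatching, 2 * m.1.card = D.numVertices := fun m => by
    have h1 := D.card_matching_white m
    have h2 := D.card_matching_black m
    have h3 := D.card_white_add_card_black
    omega
  have hdim := TorusDimer.ringKrullDim_quotient_ker hD
  obtain ⟨u, hu, -⟩ := TorusDimer.exists_vertex_degree hKT hT
  refine ⟨hcard, ?_, RingHom.ker D.matchingMap, fun q => D.isTopComponent_iff hD hdim q,
    ⟨Ideal.Quotient.isDomain _, inferInstance, TorusDimer.isIntegrallyClosed_coherentRing hD, ?_,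
      TorusDimer.canonicalModule_trivial hD hKT hK hT⟩, ?_, K, T, hKT, hK, hT,
    TorusDimer.closure_col_eq_dualSemigroup hD hKT hK hT,
    TorusDimer.exists_quotient_algEquiv hD hKT hK hT,
    fun a => TorusDimer.col_notMem_columnCone hKT hT a, u, hu⟩
  · ext m
    have h : (2 * m.1.card : ℚ) = D.numVertices := by exact_mod_cast hcard m
    have hsum : ∑ e, D.matchingMatrix e m = m.1.card := by
      simpa using D.sum_mul_matchingMatrix 1 m
    have hsum' : ∑ e, (D.matchingMatrix e m : ℚ) = m.1.card := by exact_mod_cast hsum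
    simp only [Matrix.vecMul, dotProduct, Pi.one_apply, one_mul, Matrix.map_apply, hsum',
      Pi.smul_apply, smul_eq_mul, mul_one]
    linarith
  · exact_mod_cast hdim
  · intro r Q hQ
    exact ⟨TorusDimer.add_eq_card_of_isKernelMatrix hD hQ, rfl,
      TorusDimer.range_matchingMap_eq_quotientRing hD hQ, TorusDimer.one_vecMul_eq_zero hQ⟩
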